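/- There exists a real number $\varepsilon>0$ with the following property. Let $G$ be a finite simple planar graph that contains no cycle of length $4$ (as a not necessarily induced subgraph), and let $L$ be a list assignment for $G$ that assigns to each vertex $v\in V(G)$ a set $L(v)$ of exactly five colors. Then $G$ with $L$ is weighted $\varepsilon$-flexible, that is: for every function $w$ that assigns a nonnegative real number $w(v,c)$ to each pair $(v,c)$ with $v\in V(G)$ and $c\in L(v)$, there is a proper coloring $\varphi$ of $G$ with $\varphi(v)\in L(v)$ for all $v\in V(G)$ such that \[ \sum_{v\in V(G)} w(v,\varphi(v))\ \ge\ \varepsilon\cdot\sum_{v\in V(G)}\ \sum_{c\in L(v)} w(v,c). \] -/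

import Mathlib

namespace Flexibility

open scoped BigOperators

universe u v

/-- A drawing of a simple graph in the Euclidean plane: vertices are distinct points, every edge
is a simple (continuous, not self-intersecting) arc joining its two ends, no arc passes through a
vertex other than its ends, and two different arcs share only the points of common ends. -/
structure PlaneDrawing {V : Type u} (G : SimpleGraph V) where
  /-- the point representing a vertex -/
  point : V → EuclideanSpace ℝ (Fin 2)
  /-- the set of points of the arc representing an edge (irrelevant for non-edges) -/
  arc : Sym2 V → Set (EuclideanSpace ℝ (Fin 2))
  point_injective : Function.Injective point
  arc_eq : ∀ x y : V, G.Adj x y →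
    ∃ γ : Path (point x) (point y), Function.Injective γ ∧ Set.range γ = arc s(x, y)
  vertex_on_arc : ∀ e ∈ G.edgeSet, ∀ x : V, point x ∈ arc e → x ∈ e
  arc_inter_arc : ∀ e ∈ G.edgeSet, ∀ f ∈ G.edgeSet, e ≠ f →
    ∀ p ∈ arc e ∩ arc f, ∃ x : V, x ∈ e ∧ x ∈ f ∧ p = point x

/-- A graph is planar if it has a drawing in the plane without crossings. -/
def IsPlanar {V : Type u} (G : SimpleGraph V) : Prop := Nonempty (PlaneDrawing G)

/-- `G` has no (not necessarily induced) cycle of length four. -/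
def NoFourCycle {V : Type u} (G : SimpleGraph V) : Prop :=
  ∀ (x : V) (p : G.Walk x x), p.IsCycle → p.length ≠ 4

/-- `φ` is an `L`-coloring: a proper coloring with every color taken from the list of its vertex. -/
def IsListColoring {V : Type u} {C : Type v} (G : SimpleGraph V) (L : V → Finset C)
    (φ : V → C) : Prop :=
  (∀ x y : V, G.Adj x y → φ x ≠ φ y) ∧ ∀ x : V, φ x ∈ L x

/-- A weighted request gives a nonnegative real to each pair `(x, c)` with `c ∈ L x`; the values
of `w` at other pairs are never used. -/
def IsWeightedRequest {V : Type u} {C : Type v} (L : V → Finset C) (w : V → C → ℝ) : Prop :=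
  ∀ x : V, ∀ c ∈ L x, 0 ≤ w x c

/-- The total weight `w(G, L)` of a request. -/
def totalWeight {V : Type u} {C : Type v} [Fintype V] (L : V → Finset C) (w : V → C → ℝ) : ℝ :=
  ∑ x : V, ∑ c ∈ L x, w x c

/-- A weighted request is `ε`-satisfiable if some `L`-coloring collects at least an `ε`-fraction
of the total weight. -/
def IsSatisfiable {V : Type u} {C : Type v} [Fintype V] (G : SimpleGraph V) (L : V → Finset C)
    (ε : ℝ) (w : V → C → ℝ) : Prop :=
  ∃ φ : V → C, IsListColoring G L φ ∧ ε * totalWeight L w ≤ ∑ x : V, w x (φ x)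

/-- `G` with the list assignment `L` is weighted `ε`-flexible. -/
def WeightedFlexible {V : Type u} {C : Type v} [Fintype V] (G : SimpleGraph V)
    (L : V → Finset C) (ε : ℝ) : Prop :=
  ∀ w : V → C → ℝ, IsWeightedRequest L w → IsSatisfiable G L ε w

end Flexibility

/-!
Fine grids turn a plane drawing into disjoint connected branch sets of the square grid, one for
each vertex, together with one grid edge for each edge of the graph. The boundaries of the grid
faces pull back along this model to a family of cycles that contains every edge at most twice and
spans the cycle space, as in MacLane's criterion, so no Jordan curve theorem is needed. Counting
lengths of these cycles in a graph without 4-cycles, where edge-disjointness of triangles bounds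
the number of short ones, gives `3|E| + 5 ≤ 5|V| + 2t` with `t` the number of triangles.
Discharging then yields, in every induced subgraph, a vertex of degree at most 3 or a triangle of
vertices of degree 4.

Such a configuration `H` is reducible in the sense of Dvořák, Norin and Postle: with lists of size
5 it can be recolored so that one vertex gets any color unused on its outer neighbors, or so that
any color is avoided on all neighbors in `H` of an outside vertex. Coloring the configurations one
after another, each time uniformly at random among the at most `5 ^ 3` possible recolorings, gives
a random coloring in which every color of every list appears with probability at least `(5 ^ 3) ^
(-4)`, and the expected weight of this coloring is the required fraction of the total.
-/

namespace Flexibility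

open scoped Classical

universe u v

section FourCycles

variable {V : Type u} {G : SimpleGraph V}

theorem NoFourCycle.eq_of_adj (h : NoFourCycle G) {a b c d : V} (hac : a ≠ c)
    (hab : G.Adj a b) (hcb : G.Adj c b) (had : G.Adj a d) (hcd : G.Adj c d) : b = d := by
  by_contra hbd
  refine h a (.cons hab (.cons hcb.symm (.cons hcd (.cons had.symm .nil)))) ?_ rfl
  rw [SimpleGraph.Walk.cons_isCycle_iff, SimpleGraph.Walk.isPath_def]
  simp only [SimpleGraph.Walk.support_cons, SimpleGraph.Walk.support_nil,
    SimpleGraph.Walk.edges_cons, SimpleGraph.Walk.edges_nil]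
  grind [hab.ne, hcb.ne, had.ne, hcd.ne]

theorem NoFourCycle.induce (h : NoFourCycle G) (s : Set V) : NoFourCycle (G.induce s) := by
  intro x p hp
  have hinj : Function.Injective (SimpleGraph.Embedding.induce (G := G) s).toHom :=
    Subtype.val_injective
  rw [← p.length_map (SimpleGraph.Embedding.induce s).toHom]
  exact h _ _ ((SimpleGraph.Walk.isCycle_map_iff_of_injective hinj).2 hp)

theorem exists_eq_triple_of_isNClique {T : Finset V} (hT : G.IsNClique 3 T) {x y : V}
    (hx : x ∈ T) (hy : y ∈ T) (hxy : x ≠ y) :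
    ∃ z, G.Adj x z ∧ G.Adj y z ∧ T = {x, y, z} := by
  have hy' : y ∈ T.erase x := Finset.mem_erase.2 ⟨hxy.symm, hy⟩
  have hcard : ((T.erase x).erase y).card = 1 := by
    rw [Finset.card_erase_of_mem hy', Finset.card_erase_of_mem hx, hT.card_eq]
  obtain ⟨z, hz⟩ := Finset.card_eq_one.1 hcard
  have hzT : z ∈ (T.erase x).erase y := by simp [hz]
  simp only [Finset.mem_erase] at hzT
  exact ⟨z, hT.isClique hx hzT.2.2 hzT.2.1.symm, hT.isClique hy hzT.2.2 hzT.1.symm,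
    by rw [← hz, Finset.insert_erase hy', Finset.insert_erase hx]⟩

theorem NoFourCycle.isNClique_three_eq (h : NoFourCycle G) {T T' : Finset V}
    (hT : G.IsNClique 3 T) (hT' : G.IsNClique 3 T') {x y : V} (hxy : x ≠ y)
    (hx : x ∈ T) (hy : y ∈ T) (hx' : x ∈ T') (hy' : y ∈ T') : T = T' := by
  obtain ⟨z, hxz, hyz, rfl⟩ := exists_eq_triple_of_isNClique hT hx hy hxy
  obtain ⟨z', hxz', hyz', rfl⟩ := exists_eq_triple_of_isNClique hT' hx' hy' hxy
  rw [h.eq_of_adj hxy hxz hyz hxz' hyz']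

end FourCycles

section EvenEdges

variable {V : Type u}

/-- An edge set is even if every vertex lies in an even number of its members. These are the
elements of the binary cycle space, viewed as sets. -/
def EvenEdges (S : Finset (Sym2 V)) : Prop := ∀ x : V, Even (S.filter (x ∈ ·)).card

/-- The edges of the complete graph on a set of vertices. -/
noncomputable def cliqueEdges (T : Finset V) : Finset (Sym2 V) := T.sym2.filter fun e ↦ ¬ e.IsDiag

theorem cliqueEdges_triple {a b c : V} (hab : a ≠ b) (hac : a ≠ c) (hbc : b ≠ c) :
    cliqueEdges {a, b, c} = {s(a, b), s(a, c), s(b, c)} := by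
  ext e
  induction e using Sym2.ind with
  | _ x y =>
    simp only [cliqueEdges, Finset.mem_filter, Finset.mk_mem_sym2_iff, Finset.mem_insert,
      Finset.mem_singleton, Sym2.mk_isDiag_iff]
    grind

theorem evenEdges_triple {a b c : V} (hab : a ≠ b) (hac : a ≠ c) (hbc : b ≠ c) :
    EvenEdges ({s(a, b), s(a, c), s(b, c)} : Finset (Sym2 V)) := by
  intro x
  simp only [Finset.filter_insert, Finset.filter_singleton, Sym2.mem_iff]
  split_ifs <;> grind [even_two]

variable {S T : Finset (Sym2 V)}

theorem EvenEdges.exists_other (hS : EvenEdges S) {a b : V} (hab : s(a, b) ∈ S) :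
    ∃ c, c ≠ b ∧ s(a, c) ∈ S := by
  have hmem : s(a, b) ∈ S.filter (a ∈ ·) := by simp [hab]
  have hone : 1 < (S.filter (a ∈ ·)).card := by
    have hpos := Finset.card_pos.2 ⟨_, hmem⟩
    obtain ⟨k, hk⟩ := hS a
    omega
  obtain ⟨e, he, hne⟩ := Finset.exists_mem_ne hone s(a, b)
  obtain ⟨heS, hae⟩ := Finset.mem_filter.1 he
  obtain ⟨c, rfl⟩ := Sym2.mem_iff_exists.1 hae
  exact ⟨c, fun h ↦ hne (by rw [h]), heS⟩

theorem EvenEdges.sdiff (hS : EvenEdges S) (hT : EvenEdges T) (hTS : T ⊆ S) :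
    EvenEdges (S \ T) := by
  intro x
  have hfilter : (S \ T).filter (x ∈ ·) = S.filter (x ∈ ·) \ T.filter (x ∈ ·) := by grind
  rw [hfilter, Finset.card_sdiff_of_subset (Finset.filter_subset_filter _ hTS)]
  exact (hS x).tsub (hT x)

theorem EvenEdges.three_le_card (hS : EvenEdges S) (hdiag : ∀ e ∈ S, ¬ e.IsDiag)
    (hne : S.Nonempty) : 3 ≤ S.card := by
  obtain ⟨⟨a, b⟩, he⟩ := hne
  change s(a, b) ∈ S at he
  have hab : a ≠ b := hdiag _ he
  obtain ⟨c, hcb, hac⟩ := hS.exists_other he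
  obtain ⟨d, hda, hbd⟩ := hS.exists_other (Sym2.eq_swap ▸ he : s(b, a) ∈ S)
  have hcard : ({s(a, b), s(a, c), s(b, d)} : Finset (Sym2 V)).card = 3 :=
    Finset.card_eq_three.2 ⟨_, _, _, by grind, by grind, by grind, rfl⟩
  exact hcard ▸ Finset.card_le_card (by simp [Finset.insert_subset_iff, *])

theorem EvenEdges.eq_or_card_add_three_le (hS : EvenEdges S) (hT : EvenEdges T) (hTS : T ⊆ S)
    (hdiag : ∀ e ∈ S, ¬ e.IsDiag) : S = T ∨ T.card + 3 ≤ S.card := by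
  rcases (S \ T).eq_empty_or_nonempty with hempty | hne
  · exact .inl ((Finset.sdiff_eq_empty_iff_subset.1 hempty).antisymm hTS)
  · have h := (hS.sdiff hT hTS).three_le_card
      (fun e he ↦ hdiag e (Finset.sdiff_subset he)) hne
    rw [Finset.card_sdiff_of_subset hTS] at h
    exact .inr (by omega)

theorem EvenEdges.five_le_card_of_path {G : SimpleGraph V} (hC : NoFourCycle G)
    (hS : EvenEdges S) (hG : ∀ e ∈ S, e ∈ G.edgeSet) {a b c d : V} (hcb : c ≠ b) (hda : d ≠ a)
    (hcd : c ≠ d) (hab : s(a, b) ∈ S) (hac : s(a, c) ∈ S) (hbd : s(b, d) ∈ S) :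
    5 ≤ S.card := by
  obtain ⟨g, hga, hcg⟩ := hS.exists_other (Sym2.eq_swap ▸ hac : s(c, a) ∈ S)
  obtain ⟨h, hhb, hdh⟩ := hS.exists_other (Sym2.eq_swap ▸ hbd : s(d, b) ∈ S)
  have hadj : ∀ {x y}, s(x, y) ∈ S → G.Adj x y := fun hxy ↦ hG _ hxy
  have hgd : g ≠ d := fun hgd ↦ hda <| Eq.symm <|
    hC.eq_of_adj hcb (hadj hac).symm (hadj hab).symm (hgd ▸ hadj hcg) (hadj hbd)
  have hne := And.intro (hadj hab).ne <| And.intro (hadj hac).ne (hadj hbd).ne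
  have hcard : ({s(a, b), s(a, c), s(b, d), s(c, g), s(d, h)} : Finset (Sym2 V)).card = 5 := by
    rw [Finset.card_insert_of_notMem, Finset.card_insert_of_notMem,
      Finset.card_insert_of_notMem, Finset.card_pair] <;>
    grind
  exact hcard ▸ Finset.card_le_card (by simp [Finset.insert_subset_iff, *])

theorem EvenEdges.eq_cliqueEdges_or_five_le_card {G : SimpleGraph V} (hC : NoFourCycle G)
    (hS : EvenEdges S) (hG : ∀ e ∈ S, e ∈ G.edgeSet) (hne : S.Nonempty) :
    (∃ T, G.IsNClique 3 T ∧ S = cliqueEdges T) ∨ 5 ≤ S.card := by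
  obtain ⟨⟨a, b⟩, hab⟩ := hne
  change s(a, b) ∈ S at hab
  obtain ⟨c, hcb, hac⟩ := hS.exists_other hab
  obtain ⟨d, hda, hbd⟩ := hS.exists_other (Sym2.eq_swap ▸ hab : s(b, a) ∈ S)
  rcases ne_or_eq c d with hcd | rfl
  · exact .inr (hS.five_le_card_of_path hC hG hcb hda hcd hab hac hbd)
  have hadj : ∀ {x y}, s(x, y) ∈ S → G.Adj x y := fun hxy ↦ hG _ hxy
  have hne : a ≠ b ∧ a ≠ c ∧ b ≠ c := ⟨(hadj hab).ne, (hadj hac).ne, (hadj hbd).ne⟩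
  have hcard : ({s(a, b), s(a, c), s(b, c)} : Finset (Sym2 V)).card = 3 :=
    Finset.card_eq_three.2 ⟨_, _, _, by grind, by grind, by grind, rfl⟩
  rcases hS.eq_or_card_add_three_le (evenEdges_triple hne.1 hne.2.1 hne.2.2)
    (by simp [Finset.insert_subset_iff, *])
    (fun e he ↦ G.not_isDiag_of_mem_edgeSet (hG e he)) with hSabc | hle
  · refine .inl ⟨{a, b, c}, SimpleGraph.is3Clique_iff.2 ⟨a, b, c, hadj hab, hadj hac, hadj hbd,
      rfl⟩, ?_⟩
    rw [cliqueEdges_triple hne.1 hne.2.1 hne.2.2, hSabc]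
  · exact .inr (by omega)

end EvenEdges

section Discharging

variable {V : Type u} [Fintype V] {G : SimpleGraph V}

theorem two_mul_card_triangles_le_degree (hC : NoFourCycle G) (x : V) :
    2 * ((G.cliqueFinset 3).filter (x ∈ ·)).card ≤ G.degree x := by
  have hmem {T : Finset V} (hT : T ∈ (G.cliqueFinset 3).filter (x ∈ ·)) :
      G.IsNClique 3 T ∧ x ∈ T := by
    simpa [SimpleGraph.mem_cliqueFinset_iff] using hT
  have hdisj : ((G.cliqueFinset 3).filter (x ∈ ·) : Set (Finset V)).PairwiseDisjoint
      (fun T ↦ T.erase x) := by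
    intro T hT T' hT' hne
    refine Finset.disjoint_left.2 fun y hy hy' ↦ hne ?_
    obtain ⟨hyx, hy⟩ := Finset.mem_erase.1 hy
    exact hC.isNClique_three_eq (hmem hT).1 (hmem hT').1 hyx.symm (hmem hT).2 hy (hmem hT').2
      (Finset.mem_of_mem_erase hy')
  calc 2 * ((G.cliqueFinset 3).filter (x ∈ ·)).card
      = ∑ T ∈ (G.cliqueFinset 3).filter (x ∈ ·), (T.erase x).card := by
        rw [mul_comm, Finset.sum_const_nat]
        intro T hT
        rw [Finset.card_erase_of_mem (hmem hT).2, (hmem hT).1.card_eq]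
    _ = (((G.cliqueFinset 3).filter (x ∈ ·)).biUnion fun T ↦ T.erase x).card :=
        (Finset.card_biUnion hdisj).symm
    _ ≤ G.degree x := by
        rw [← SimpleGraph.card_neighborFinset_eq_degree]
        refine Finset.card_le_card fun y hy ↦ ?_
        obtain ⟨T, hT, hy⟩ := Finset.mem_biUnion.1 hy
        obtain ⟨hyx, hy⟩ := Finset.mem_erase.1 hy
        exact (G.mem_neighborFinset x y).2 ((hmem hT).1.isClique (hmem hT).2 hy hyx.symm)

-- Discharging: a vertex of degree four pays 3, any other vertex pays 6, to each of its triangles.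
theorem exists_light_configuration (hC : NoFourCycle G)
    (hB : 3 * G.edgeFinset.card + 5 ≤ 5 * Fintype.card V + 2 * (G.cliqueFinset 3).card) :
    (∃ x, G.degree x ≤ 3) ∨ ∃ T, G.IsNClique 3 T ∧ ∀ x ∈ T, G.degree x = 4 := by
  by_contra! ⟨hdeg, htri⟩
  let pay : V → ℕ := fun x ↦ if G.degree x = 4 then 3 else 6
  have hreceived : ∀ T ∈ G.cliqueFinset 3, 12 ≤ ∑ x ∈ T, pay x := by
    intro T hT
    rw [SimpleGraph.mem_cliqueFinset_iff] at hT
    obtain ⟨x, hx, hx4⟩ := htri T hT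
    have hrest : (T.erase x).card • 3 ≤ ∑ y ∈ T.erase x, pay y :=
      Finset.card_nsmul_le_sum _ _ _ fun y _ ↦ by simp only [pay]; split_ifs <;> omega
    rw [Finset.card_erase_of_mem hx, hT.card_eq] at hrest
    rw [← Finset.add_sum_erase _ _ hx, show pay x = 6 from if_neg hx4]
    simp only [smul_eq_mul] at hrest
    omega
  have hpaid : ∀ x, ((G.cliqueFinset 3).filter (x ∈ ·)).card * pay x + 30 ≤ 9 * G.degree x := by
    intro x
    have hx := two_mul_card_triangles_le_degree hC x
    have hdegx := hdeg x
    simp only [pay]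
    split_ifs <;> omega
  have hcount : ∑ T ∈ G.cliqueFinset 3, ∑ x ∈ T, pay x =
      ∑ x, ((G.cliqueFinset 3).filter (x ∈ ·)).card * pay x := by
    rw [Finset.sum_comm' (t' := Finset.univ) (s' := fun x ↦ (G.cliqueFinset 3).filter (x ∈ ·))
      (by simp)]
    simp only [Finset.sum_const, smul_eq_mul]
  have hlow := Finset.card_nsmul_le_sum _ _ _ hreceived
  have hhigh := Finset.sum_le_sum fun x (_ : x ∈ Finset.univ) ↦ hpaid x
  rw [Finset.sum_add_distrib, ← hcount, ← Finset.mul_sum,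
    SimpleGraph.sum_degrees_eq_twice_card_edges, Finset.sum_const, Finset.card_univ] at hhigh
  simp only [smul_eq_mul] at hlow hhigh
  omega

end Discharging

section CycleSpace

variable {V : Type u} [Fintype V]

/-- The boundary map modulo two, from edge chains to vertex chains. -/
noncomputable def boundary (G : SimpleGraph V) : (G.edgeSet → ZMod 2) →ₗ[ZMod 2] (V → ZMod 2) :=
  ((G.incMatrix (ZMod 2)).submatrix id Subtype.val).mulVecLin

/-- The binary cycle space of a graph. -/
noncomputable def cycleSpace (G : SimpleGraph V) : Submodule (ZMod 2) (G.edgeSet → ZMod 2) :=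
  LinearMap.ker (boundary G)

variable {G : SimpleGraph V}

theorem boundary_apply (z : G.edgeSet → ZMod 2) (x : V) :
    boundary G z x = ∑ e : G.edgeSet, if x ∈ (e : Sym2 V) then z e else 0 := by
  simp only [boundary, Matrix.mulVecLin_apply, Matrix.mulVec, dotProduct,
    Matrix.submatrix_apply, id_eq, SimpleGraph.incMatrix_apply', SimpleGraph.incidenceSet,
    Set.mem_ofPred_eq, Subtype.coe_prop, true_and, ite_mul, one_mul, zero_mul]

theorem sum_boundary (z : G.edgeSet → ZMod 2) : ∑ x, boundary G z x = 0 := by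
  simp only [boundary, Matrix.mulVecLin_apply, Matrix.mulVec, dotProduct, Matrix.submatrix_apply,
    id_eq]
  rw [Finset.sum_comm]
  refine Finset.sum_eq_zero fun e _ ↦ ?_
  rw [← Finset.sum_mul, G.sum_incMatrix_apply_of_mem_edgeSet e.2]
  exact mul_eq_zero_of_left CharTwo.two_eq_zero _

theorem card_edgeSet_lt_finrank_cycleSpace_add [Nonempty V] :
    Fintype.card G.edgeSet < Module.finrank (ZMod 2) (cycleSpace G) + Fintype.card V := by
  obtain ⟨x⟩ := ‹Nonempty V›
  have hrange : LinearMap.range (boundary G) < ⊤ := by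
    refine lt_top_iff_ne_top.2 fun htop ↦ ?_
    obtain ⟨z, hz⟩ := LinearMap.range_eq_top.1 htop (Pi.single x 1)
    have hsum := sum_boundary z
    rw [hz, Finset.sum_pi_single'] at hsum
    simp at hsum
  have hlt := Submodule.finrank_lt hrange.ne
  have hrank := LinearMap.finrank_range_add_finrank_ker (boundary G)
  rw [Module.finrank_fintype_fun_eq_card] at hlt hrank
  rw [cycleSpace]
  omega

/-- The set of edges on which a chain does not vanish. -/
noncomputable def chainSupport (z : G.edgeSet → ZMod 2) : Finset (Sym2 V) :=
  (Finset.univ.filter fun e ↦ z e ≠ 0).map (Function.Embedding.subtype _)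

theorem mem_chainSupport {z : G.edgeSet → ZMod 2} {e : Sym2 V} :
    e ∈ chainSupport z ↔ ∃ h : e ∈ G.edgeSet, z ⟨e, h⟩ ≠ 0 := by
  simp [chainSupport]

theorem chainSupport_injective : Function.Injective (chainSupport (G := G)) := by
  intro z z' h
  ext1 e
  have hiff : z e ≠ 0 ↔ z' e ≠ 0 := by simpa [mem_chainSupport] using Finset.ext_iff.1 h e
  have hdet : ∀ a b : ZMod 2, (a ≠ 0 ↔ b ≠ 0) → a = b := by decide
  exact hdet _ _ hiff

theorem evenEdges_chainSupport {z : G.edgeSet → ZMod 2} (hz : z ∈ cycleSpace G) :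
    EvenEdges (chainSupport z) := by
  intro x
  have hx := congrFun (LinearMap.mem_ker.1 hz) x
  rw [boundary_apply, Pi.zero_apply] at hx
  rw [← ZMod.natCast_eq_zero_iff_even, ← hx, chainSupport, Finset.filter_map, Finset.card_map,
    Finset.filter_filter, Finset.card_filter, Nat.cast_sum]
  refine Finset.sum_congr rfl fun e _ ↦ ?_
  have hval : ∀ a : ZMod 2, ((if a ≠ 0 then 1 else 0 : ℕ) : ZMod 2) = a := by decide
  by_cases hxe : x ∈ (e : Sym2 V)
  · simpa [hxe] using hval (z e)
  · simp [hxe]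

end CycleSpace

section TwoBasis

variable {V : Type u} [Fintype V] {G : SimpleGraph V}

/-- MacLane's condition: the cycle space has a basis in which no edge is used more than twice.
Here it replaces the facial cycles of a plane graph. -/
def HasTwoBasis (G : SimpleGraph V) : Prop :=
  ∃ B : Finset (G.edgeSet → ZMod 2), LinearIndepOn (ZMod 2) id (B : Set (G.edgeSet → ZMod 2)) ∧
    Submodule.span (ZMod 2) B = cycleSpace G ∧ ∀ e, (B.filter (· e ≠ 0)).card ≤ 2

theorem card_filter_small_support_le (hC : NoFourCycle G) {B : Finset (G.edgeSet → ZMod 2)}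
    (hB : ∀ z ∈ B, z ∈ cycleSpace G ∧ z ≠ 0) :
    (B.filter fun z ↦ (chainSupport z).card < 5).card ≤ (G.cliqueFinset 3).card := by
  refine Finset.card_le_card_of_forall_subsingleton (fun z T ↦ chainSupport z = cliqueEdges T)
    (fun z hz ↦ ?_) fun T _ z hz z' hz' ↦ chainSupport_injective (hz.2.trans hz'.2.symm)
  obtain ⟨hzB, hlt⟩ := Finset.mem_filter.1 hz
  obtain ⟨e, he⟩ := Function.ne_iff.1 (hB z hzB).2
  rcases (evenEdges_chainSupport (hB z hzB).1).eq_cliqueEdges_or_five_le_card hC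
    (fun e he ↦ (mem_chainSupport.1 he).1) ⟨e, mem_chainSupport.2 ⟨e.2, he⟩⟩ with
    ⟨T, hT, hzT⟩ | hle
  · exact ⟨T, SimpleGraph.mem_cliqueFinset_iff.2 hT, hzT⟩
  · omega

theorem HasTwoBasis.edge_bound [Nonempty V] (hC : NoFourCycle G) (h : HasTwoBasis G) :
    3 * G.edgeFinset.card + 5 ≤ 5 * Fintype.card V + 2 * (G.cliqueFinset 3).card := by
  obtain ⟨B, hli, hspan, htwo⟩ := h
  have hB : ∀ z ∈ B, z ∈ cycleSpace G ∧ z ≠ 0 := fun z hz ↦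
    ⟨hspan ▸ Submodule.subset_span hz, hli.ne_zero hz⟩
  have hcard : Fintype.card G.edgeSet < B.card + Fintype.card V := by
    rw [← finrank_span_finset_eq_card (R := ZMod 2) hli, hspan]
    exact card_edgeSet_lt_finrank_cycleSpace_add
  have hupper : ∑ z ∈ B, (chainSupport z).card ≤ Fintype.card G.edgeSet * 2 := by
    have hcount := Finset.sum_card_bipartiteAbove_eq_sum_card_bipartiteBelow
      (s := B) (t := Finset.univ) (fun z (e : G.edgeSet) ↦ z e ≠ 0)
    simp only [chainSupport, Finset.card_map]
    exact hcount.trans_le (Finset.sum_le_card_nsmul _ _ _ fun e _ ↦ htwo e)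
  have hlower : B.card * 5 ≤
      ∑ z ∈ B, (chainSupport z).card + 2 * (B.filter fun z ↦ (chainSupport z).card < 5).card := by
    rw [Finset.card_filter, Finset.mul_sum, ← Finset.sum_add_distrib]
    refine Finset.card_nsmul_le_sum B _ 5 fun z hz ↦ ?_
    obtain ⟨e, he⟩ := Function.ne_iff.1 (hB z hz).2
    have hthree := (evenEdges_chainSupport (hB z hz).1).three_le_card
      (fun e he ↦ G.not_isDiag_of_mem_edgeSet (mem_chainSupport.1 he).1)
      ⟨e, mem_chainSupport.2 ⟨e.2, he⟩⟩
    split_ifs <;> omega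
  have hsmall := card_filter_small_support_le hC hB
  rw [SimpleGraph.edgeFinset, Set.toFinset_card]
  omega

/-- The boundary of a face `k`, when the edge `e` separates the faces `l e` and `r e`. -/
noncomputable def faceBoundary {E F : Type*} (l r : E → F) (k : F) (e : E) : ZMod 2 :=
  Pi.single (M := fun _ ↦ ZMod 2) k 1 (l e) + Pi.single (M := fun _ ↦ ZMod 2) k 1 (r e)

theorem span_faceBoundary {F : Type*} (l r : G.edgeSet → F)
    (h : ∀ y, y ∈ cycleSpace G ↔ ∃ S : F → ZMod 2, ∀ e, y e = S (l e) + S (r e)) :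
    Submodule.span (ZMod 2) (Set.range (faceBoundary l r)) = cycleSpace G := by
  refine le_antisymm (Submodule.span_le.2 ?_) fun y hy ↦ ?_
  · rintro _ ⟨k, rfl⟩
    exact (h _).2 ⟨Pi.single k 1, fun e ↦ rfl⟩
  · obtain ⟨S, hS⟩ := (h y).1 hy
    let K : Finset F := Finset.univ.image l ∪ Finset.univ.image r
    have hl : ∀ e, l e ∈ K := fun e ↦ by simp [K]
    have hr : ∀ e, r e ∈ K := fun e ↦ by simp [K]
    have hy : y = ∑ k ∈ K, S k • faceBoundary l r k := by
      ext1 e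
      simp [hS e, faceBoundary, mul_add, Finset.sum_add_distrib, Pi.single_apply, hl, hr]
    rw [hy]
    exact Submodule.sum_mem _ fun k _ ↦
      Submodule.smul_mem _ _ (Submodule.subset_span (Set.mem_range_self k))

theorem hasTwoBasis_of_dual {F : Type*} (l r : G.edgeSet → F)
    (h : ∀ y, y ∈ cycleSpace G ↔ ∃ S : F → ZMod 2, ∀ e, y e = S (l e) + S (r e)) :
    HasTwoBasis G := by
  obtain ⟨B, hBsub, hBspan, hli⟩ :=
    exists_linearIndependent (ZMod 2) (Set.range (faceBoundary l r))
  obtain ⟨B, rfl⟩ := hli.setFinite.exists_finset_coe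
  refine ⟨B, hli, hBspan.trans (span_faceBoundary l r h), fun e ↦ ?_⟩
  refine (Finset.card_le_card (t := {faceBoundary l r (l e), faceBoundary l r (r e)}) ?_).trans
    Finset.card_le_two
  intro z hz
  obtain ⟨hzB, hze⟩ := Finset.mem_filter.1 hz
  obtain ⟨k, rfl⟩ := hBsub hzB
  by_contra hk
  simp only [Finset.mem_insert, Finset.mem_singleton, not_or] at hk
  refine hze ?_
  rw [faceBoundary, Pi.single_eq_of_ne (fun hl ↦ hk.1 (by rw [hl])),
    Pi.single_eq_of_ne (fun hr ↦ hk.2 (by rw [hr])), add_zero]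

end TwoBasis

section Grid

/-- The four neighbours of a point of the integer grid. -/
def gridNeighbors (p : ℤ × ℤ) : Finset (ℤ × ℤ) :=
  {(p.1 + 1, p.2), (p.1 - 1, p.2), (p.1, p.2 + 1), (p.1, p.2 - 1)}

theorem mem_gridNeighbors {p q : ℤ × ℤ} : q ∈ gridNeighbors p ↔
    q = (p.1 + 1, p.2) ∨ q = (p.1 - 1, p.2) ∨ q = (p.1, p.2 + 1) ∨ q = (p.1, p.2 - 1) := by
  simp [gridNeighbors]

/-- The integer grid graph, onto which plane drawings are discretized. -/
def grid : SimpleGraph (ℤ × ℤ) where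
  Adj p q := q ∈ gridNeighbors p
  symm := ⟨fun p q h ↦ by
    rw [mem_gridNeighbors] at *
    rcases h with rfl | rfl | rfl | rfl <;> simp⟩
  loopless := ⟨fun p h ↦ by
    simp only [mem_gridNeighbors, Prod.ext_iff] at h
    omega⟩

theorem grid_adj {p q : ℤ × ℤ} : grid.Adj p q ↔ q ∈ gridNeighbors p := Iff.rfl

/-- The horizontal grid edge with left end `(i, j)`. -/
def hEdge (i j : ℤ) : Sym2 (ℤ × ℤ) := s((i, j), (i + 1, j))

/-- The vertical grid edge with lower end `(i, j)`. -/
def vEdge (i j : ℤ) : Sym2 (ℤ × ℤ) := s((i, j), (i, j + 1))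

theorem eq_hEdge_or_vEdge_of_mem_edgeSet {e : Sym2 (ℤ × ℤ)} (he : e ∈ grid.edgeSet) :
    ∃ i j, e = hEdge i j ∨ e = vEdge i j := by
  induction e using Sym2.ind with
  | _ p q =>
    rw [SimpleGraph.mem_edgeSet, grid_adj, mem_gridNeighbors] at he
    obtain ⟨i, j⟩ := p
    rcases he with rfl | rfl | rfl | rfl
    · exact ⟨i, j, .inl rfl⟩
    · exact ⟨i - 1, j, .inl (by rw [hEdge, sub_add_cancel, Sym2.eq_swap])⟩
    · exact ⟨i, j, .inr rfl⟩
    · exact ⟨i, j - 1, .inr (by rw [vEdge, sub_add_cancel, Sym2.eq_swap])⟩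

theorem sum_gridNeighbors {M : Type*} [AddCommMonoid M] (c : Sym2 (ℤ × ℤ) → M) (i j : ℤ) :
    ∑ q ∈ gridNeighbors (i, j), c s((i, j), q) =
      c (hEdge i j) + (c (hEdge (i - 1) j) + (c (vEdge i j) + c (vEdge i (j - 1)))) := by
  rw [gridNeighbors, Finset.sum_insert, Finset.sum_insert, Finset.sum_pair]
  · simp only [hEdge, vEdge, sub_add_cancel, Sym2.eq_swap]
  all_goals simp only [Finset.mem_insert, Finset.mem_singleton, ne_eq, Prod.ext_iff]; omega

/-- A binary chain on the grid is closed if its boundary vanishes at every grid point. -/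
def GridClosed (c : Sym2 (ℤ × ℤ) → ZMod 2) : Prop :=
  ∀ p, ∑ q ∈ gridNeighbors p, c s(p, q) = 0

end Grid

section Cells

/-- The cell above a horizontal, or to the right of a vertical, grid edge. A cell is named by its
lower left corner. -/
def upperRightCell (e : Sym2 (ℤ × ℤ)) : ℤ × ℤ := e.inf

/-- The cell below a horizontal, or to the left of a vertical, grid edge. -/
def lowerLeftCell (e : Sym2 (ℤ × ℤ)) : ℤ × ℤ := e.inf - (e.sup - e.inf).swap

theorem upperRightCell_hEdge (i j : ℤ) : upperRightCell (hEdge i j) = (i, j) := by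
  simp [upperRightCell, hEdge]

theorem upperRightCell_vEdge (i j : ℤ) : upperRightCell (vEdge i j) = (i, j) := by
  simp [upperRightCell, vEdge]

theorem lowerLeftCell_hEdge (i j : ℤ) : lowerLeftCell (hEdge i j) = (i, j - 1) := by
  simp [lowerLeftCell, hEdge]

theorem lowerLeftCell_vEdge (i j : ℤ) : lowerLeftCell (vEdge i j) = (i - 1, j) := by
  simp [lowerLeftCell, vEdge]

theorem gridClosed_cells (t : ℤ × ℤ → ZMod 2) :
    GridClosed fun e ↦ t (upperRightCell e) + t (lowerLeftCell e) := by
  rintro ⟨i, j⟩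
  rw [sum_gridNeighbors fun e ↦ t (upperRightCell e) + t (lowerLeftCell e)]
  simp only [upperRightCell_hEdge, upperRightCell_vEdge, lowerLeftCell_hEdge,
    lowerLeftCell_vEdge]
  grind

variable {c : Sym2 (ℤ × ℤ) → ZMod 2} {N : ℤ}

/-- The sum of a chain over the horizontal edges of column `i` between heights `N` and `j`: the
potential of the cell `(i, j)`. -/
noncomputable def columnSum (c : Sym2 (ℤ × ℤ) → ZMod 2) (N i j : ℤ) : ZMod 2 :=
  ∑ k ∈ Finset.Icc N j, c (hEdge i k)

theorem columnSum_of_lt {i j : ℤ} (hj : j < N) : columnSum c N i j = 0 := by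
  rw [columnSum, Finset.Icc_eq_empty (by omega), Finset.sum_empty]

theorem columnSum_eq_sub_one_add (hN : ∀ p q, p.2 < N → c s(p, q) = 0) (i j : ℤ) :
    columnSum c N i j = columnSum c N i (j - 1) + c (hEdge i j) := by
  rcases lt_or_ge j N with hj | hj
  · rw [columnSum_of_lt hj, columnSum_of_lt (by omega), hEdge, hN _ _ hj, add_zero]
  · rw [columnSum, columnSum, add_comm, ← Finset.sum_insert (f := fun k ↦ c (hEdge i k)) (by simp)]
    congr 1
    grind

theorem GridClosed.columnSum_add (hc : GridClosed c) (hN : ∀ p q, p.2 < N → c s(p, q) = 0)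
    (i j : ℤ) : columnSum c N i j + columnSum c N (i - 1) j = c (vEdge i j) := by
  rcases lt_or_ge j (N - 1) with hj | hj
  · rw [columnSum_of_lt (by omega), columnSum_of_lt (by omega), vEdge, hN _ _ (by grind), add_zero]
  induction j, hj using Int.leInduction with
  | base =>
    rw [columnSum_of_lt (by omega), columnSum_of_lt (by omega), vEdge, hN _ _ (by simp), add_zero]
  | succ j hj ih =>
    rw [columnSum_eq_sub_one_add hN i, columnSum_eq_sub_one_add hN (i - 1)]
    have hclosed := hc (i, j + 1)
    rw [sum_gridNeighbors] at hclosed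
    rw [add_sub_cancel_right] at hclosed ⊢
    grind

theorem GridClosed.exists_cell_potential (hc : GridClosed c)
    (hN : ∀ p q, p.2 < N → c s(p, q) = 0) : ∃ t : ℤ × ℤ → ZMod 2,
      ∀ e ∈ grid.edgeSet, c e = t (upperRightCell e) + t (lowerLeftCell e) := by
  refine ⟨fun x ↦ columnSum c N x.1 x.2, fun e he ↦ ?_⟩
  obtain ⟨i, j, rfl | rfl⟩ := eq_hEdge_or_vEdge_of_mem_edgeSet he
  · simp only [upperRightCell_hEdge, lowerLeftCell_hEdge, columnSum_eq_sub_one_add hN i j]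
    grind
  · simp only [upperRightCell_vEdge, lowerLeftCell_vEdge, hc.columnSum_add hN]

end Cells

section GridChains

variable {c : Sym2 (ℤ × ℤ) → ZMod 2}

theorem GridClosed.sum_boundary_edges (hc : GridClosed c) (B : Finset (ℤ × ℤ)) :
    ∑ p ∈ B, ∑ q ∈ gridNeighbors p with q ∉ B, c s(p, q) = 0 := by
  have hinner : ∑ p ∈ B, ∑ q ∈ gridNeighbors p with q ∈ B, c s(p, q) = 0 := by
    rw [Finset.sum_sigma']
    refine Finset.sum_involution (fun x _ ↦ ⟨x.2, x.1⟩) (fun x _ ↦ ?_) (fun x hx _ heq ↦ ?_)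
      (fun x hx ↦ ?_) fun x _ ↦ rfl
    · rw [Sym2.eq_swap, CharTwo.add_self_eq_zero]
    · simp only [Finset.mem_sigma, Finset.mem_filter, ← grid_adj] at hx
      exact hx.2.1.ne (congrArg Sigma.snd heq)
    · simp only [Finset.mem_sigma, Finset.mem_filter, ← grid_adj] at hx ⊢
      exact ⟨hx.2.2, hx.2.1.symm, hx.1⟩
  have hall : ∑ p ∈ B, ∑ q ∈ gridNeighbors p, c s(p, q) = 0 :=
    Finset.sum_eq_zero fun p _ ↦ hc p
  simpa only [← Finset.sum_filter_add_sum_filter_not (gridNeighbors _) (· ∈ B),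
    Finset.sum_add_distrib, hinner, zero_add] using hall

theorem sum_gridNeighbors_single {a b : ℤ × ℤ} (hab : grid.Adj a b) (p : ℤ × ℤ) :
    ∑ q ∈ gridNeighbors p, (if s(a, b) = s(p, q) then (1 : ZMod 2) else 0) =
      (if p = a then 1 else 0) + (if p = b then 1 else 0) := by
  have hne := hab.ne
  by_cases hpa : p = a
  · subst hpa
    have hiff : ∀ q, s(p, b) = s(p, q) ↔ b = q := fun q ↦ Sym2.congr_right
    simp only [hiff, Finset.sum_ite_eq, if_pos (grid_adj.1 hab), if_true, if_neg hne, add_zero]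
  by_cases hpb : p = b
  · subst hpb
    have hiff : ∀ q, s(a, p) = s(p, q) ↔ a = q := fun q ↦ by rw [Sym2.eq_swap, Sym2.congr_right]
    simp only [hiff, Finset.sum_ite_eq, if_pos (grid_adj.1 hab.symm), if_true, if_neg hne.symm,
      zero_add]
  · rw [if_neg hpa, if_neg hpb, add_zero]
    exact Finset.sum_eq_zero fun q _ ↦ if_neg (by grind)

theorem sum_gridNeighbors_count_edges {a b : ℤ × ℤ} (w : grid.Walk a b) (p : ℤ × ℤ) :
    ∑ q ∈ gridNeighbors p, (w.edges.count s(p, q) : ZMod 2) =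
      (if p = a then 1 else 0) + (if p = b then 1 else 0) := by
  induction w with
  | nil =>
    simp only [SimpleGraph.Walk.edges_nil, List.count_nil, Nat.cast_zero,
      Finset.sum_const_zero, CharTwo.add_self_eq_zero]
  | @cons a m b hadj w ih =>
    simp only [SimpleGraph.Walk.edges_cons, List.count_cons, beq_iff_eq, Nat.cast_add,
      Nat.cast_ite, Nat.cast_one, Nat.cast_zero, Finset.sum_add_distrib, ih,
      sum_gridNeighbors_single hadj]
    grind

theorem exists_forall_count_edges_eq_zero {ι : Type*} [Finite ι]
    {a b : ι → ℤ × ℤ} (w : ∀ i, grid.Walk (a i) (b i)) :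
    ∃ N : ℤ, ∀ i p q, p.2 < N → (w i).edges.count s(p, q) = 0 := by
  have hfin : (⋃ i, {p | p ∈ (w i).support}).Finite :=
    Set.finite_iUnion fun i ↦ (w i).support.finite_toSet
  obtain ⟨N, hN⟩ := (hfin.image Prod.snd).bddBelow
  refine ⟨N, fun i p q hp ↦ List.count_eq_zero_of_not_mem fun h ↦ hp.not_ge (hN ?_)⟩
  exact Set.mem_image_of_mem _ (Set.mem_iUnion.2 ⟨i, (w i).fst_mem_support_of_mem_edges h⟩)

end GridChains

section Orientation

variable {V : Type u} {G : SimpleGraph V}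

/-- The initial vertex of an edge, in an arbitrary orientation of the graph. -/
noncomputable def src (e : G.edgeSet) : V := (e : Sym2 V).out.1

/-- The terminal vertex of an edge, in the orientation of `src`. -/
noncomputable def tgt (e : G.edgeSet) : V := (e : Sym2 V).out.2

theorem mk_src_tgt (e : G.edgeSet) : s(src e, tgt e) = (e : Sym2 V) := (e : Sym2 V).out_eq

theorem mem_edge_iff {e : G.edgeSet} {x : V} : x ∈ (e : Sym2 V) ↔ x = src e ∨ x = tgt e := by
  rw [← mk_src_tgt, Sym2.mem_iff]

theorem adj_src_tgt (e : G.edgeSet) : G.Adj (src e) (tgt e) := by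
  rw [← SimpleGraph.mem_edgeSet, mk_src_tgt]
  exact e.2

theorem src_ne_tgt (e : G.edgeSet) : src e ≠ tgt e := (adj_src_tgt e).ne

end Orientation

section Linked

variable {V : Type u} {G : SimpleGraph V} {S T : Set V} {a b c : V}

/-- Two vertices are linked in a set of vertices if some walk inside the set joins them. -/
def Linked (G : SimpleGraph V) (S : Set V) (a b : V) : Prop :=
  ∃ w : G.Walk a b, ∀ x ∈ w.support, x ∈ S

theorem Linked.refl (ha : a ∈ S) : Linked G S a a := ⟨.nil, by simpa using ha⟩

theorem Linked.symm (h : Linked G S a b) : Linked G S b a := by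
  obtain ⟨w, hw⟩ := h
  exact ⟨w.reverse, by simpa using hw⟩

theorem Linked.trans (h : Linked G S a b) (h' : Linked G S b c) : Linked G S a c := by
  obtain ⟨w, hw⟩ := h
  obtain ⟨w', hw'⟩ := h'
  exact ⟨w.append w', fun x hx ↦
    ((SimpleGraph.Walk.mem_support_append_iff w w').1 hx).elim (hw x) (hw' x)⟩

theorem Linked.mono (hST : S ⊆ T) (h : Linked G S a b) : Linked G T a b := by
  obtain ⟨w, hw⟩ := h
  exact ⟨w, fun x hx ↦ hST (hw x hx)⟩

theorem Linked.of_adj (ha : a ∈ S) (hb : b ∈ S) (h : G.Adj a b) : Linked G S a b :=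
  ⟨.cons h .nil, by simp [ha, hb]⟩

end Linked

section GridModel

variable {V : Type u} {G : SimpleGraph V}

/-- A model of `G` as a minor of the integer grid: disjoint connected branch sets, one for each
vertex of `G`, and for every edge of `G` a contact, which is a grid edge between the branch sets of
its ends. -/
structure GridModel (G : SimpleGraph V) where
  /-- the branch set of a vertex -/
  branch : V → Finset (ℤ × ℤ)
  /-- a base point of each branch set -/
  root : V → ℤ × ℤ
  /-- the end of a contact in the branch set of the initial vertex -/
  contactSrc : G.edgeSet → ℤ × ℤ
  /-- the end of a contact in the branch set of the terminal vertex -/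
  contactTgt : G.edgeSet → ℤ × ℤ
  eq_of_mem : ∀ {x y p}, p ∈ branch x → p ∈ branch y → x = y
  root_mem : ∀ x, root x ∈ branch x
  linked : ∀ {x p}, p ∈ branch x → Linked grid (branch x : Set (ℤ × ℤ)) (root x) p
  contactSrc_mem : ∀ e, contactSrc e ∈ branch (src e)
  contactTgt_mem : ∀ e, contactTgt e ∈ branch (tgt e)
  adj_contact : ∀ e, grid.Adj (contactSrc e) (contactTgt e)

namespace GridModel

variable (M : GridModel G)

/-- The grid edge that represents an edge of `G`. -/
def contact (e : G.edgeSet) : Sym2 (ℤ × ℤ) := s(M.contactSrc e, M.contactTgt e)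

/-- A grid edge is inner if it lies within a single branch set. -/
def Inner (d : Sym2 (ℤ × ℤ)) : Prop := ∃ x, ∀ p ∈ d, p ∈ M.branch x

/-- The grid edges that are kept when the grid is cut down to the model; the faces of the model
arise by removing the others. -/
def Kept (d : Sym2 (ℤ × ℤ)) : Prop := M.Inner d ∨ ∃ e, M.contact e = d

variable {M}

theorem eq_src_of_contactSrc_mem {e : G.edgeSet} {x : V} (h : M.contactSrc e ∈ M.branch x) :
    x = src e :=
  M.eq_of_mem h (M.contactSrc_mem e)

theorem eq_tgt_of_contactTgt_mem {e : G.edgeSet} {x : V} (h : M.contactTgt e ∈ M.branch x) :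
    x = tgt e :=
  M.eq_of_mem h (M.contactTgt_mem e)

theorem contact_injective : Function.Injective M.contact := by
  intro e f h
  apply Subtype.ext
  rw [← mk_src_tgt e, ← mk_src_tgt f]
  have hs := M.contactSrc_mem e
  have ht := M.contactTgt_mem e
  rcases Sym2.eq_iff.1 h with ⟨h₁, h₂⟩ | ⟨h₁, h₂⟩
  · rw [h₁] at hs
    rw [h₂] at ht
    rw [eq_src_of_contactSrc_mem hs, eq_tgt_of_contactTgt_mem ht]
  · rw [h₁] at hs
    rw [h₂] at ht
    rw [eq_tgt_of_contactTgt_mem hs, eq_src_of_contactSrc_mem ht, Sym2.eq_swap]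

theorem not_inner_contact (e : G.edgeSet) : ¬ M.Inner (M.contact e) := by
  rintro ⟨x, hx⟩
  exact src_ne_tgt e ((eq_src_of_contactSrc_mem (hx _ (Sym2.mem_mk_left _ _))).symm.trans
    (eq_tgt_of_contactTgt_mem (hx _ (Sym2.mem_mk_right _ _))))

variable (M) in
/-- The contact of an edge at the vertex `x`, directed out of the branch set of `x`. -/
noncomputable def outDart (x : V) (e : G.edgeSet) : Σ _ : ℤ × ℤ, ℤ × ℤ :=
  if src e = x then ⟨M.contactSrc e, M.contactTgt e⟩ else ⟨M.contactTgt e, M.contactSrc e⟩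

theorem mk_outDart (x : V) (e : G.edgeSet) :
    s((M.outDart x e).1, (M.outDart x e).2) = M.contact e := by
  rw [outDart]
  split_ifs
  exacts [rfl, Sym2.eq_swap]

theorem outDart_mem {x : V} {e : G.edgeSet} (he : x ∈ (e : Sym2 V)) :
    M.outDart x e ∈ (M.branch x).sigma fun p ↦ {q ∈ gridNeighbors p | q ∉ M.branch x} := by
  rw [Finset.mem_sigma, Finset.mem_filter, ← grid_adj, outDart]
  rcases mem_edge_iff.1 he with rfl | rfl
  · rw [if_pos rfl]
    exact ⟨M.contactSrc_mem e, M.adj_contact e,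
      fun h ↦ src_ne_tgt e (eq_tgt_of_contactTgt_mem h)⟩
  · rw [if_neg (src_ne_tgt e)]
    exact ⟨M.contactTgt_mem e, (M.adj_contact e).symm,
      fun h ↦ src_ne_tgt e (eq_src_of_contactSrc_mem h).symm⟩

theorem exists_outDart_eq {x : V} {p q : ℤ × ℤ} (hp : p ∈ M.branch x) (hq : q ∉ M.branch x)
    (hkept : M.Kept s(p, q)) : ∃ e : G.edgeSet, x ∈ (e : Sym2 V) ∧ M.outDart x e = ⟨p, q⟩ := by
  rcases hkept with ⟨y, hy⟩ | ⟨e, he⟩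
  · obtain rfl := M.eq_of_mem hp (hy p (Sym2.mem_mk_left p q))
    exact absurd (hy q (Sym2.mem_mk_right p q)) hq
  · rcases Sym2.eq_iff.1 he with ⟨rfl, rfl⟩ | ⟨rfl, rfl⟩
    · obtain rfl := eq_src_of_contactSrc_mem hp
      exact ⟨e, mem_edge_iff.2 (.inl rfl), if_pos rfl⟩
    · obtain rfl := eq_tgt_of_contactTgt_mem hp
      exact ⟨e, mem_edge_iff.2 (.inr rfl), if_neg (src_ne_tgt e)⟩

theorem exists_walk_count_edges (e : G.edgeSet) :
    ∃ w : grid.Walk (M.root (src e)) (M.root (tgt e)), ∀ d, ¬ M.Inner d →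
      w.edges.count d = if M.contact e = d then 1 else 0 := by
  obtain ⟨w₁, h₁⟩ := M.linked (M.contactSrc_mem e)
  obtain ⟨w₂, h₂⟩ := (M.linked (M.contactTgt_mem e)).symm
  refine ⟨w₁.append (.cons (M.adj_contact e) w₂), fun d hd ↦ ?_⟩
  have hw₁ : d ∉ w₁.edges := fun h ↦
    hd ⟨_, fun p hp ↦ h₁ p (w₁.mem_support_of_mem_edges h hp)⟩
  have hw₂ : d ∉ w₂.edges := fun h ↦
    hd ⟨_, fun p hp ↦ h₂ p (w₂.mem_support_of_mem_edges h hp)⟩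
  simp only [SimpleGraph.Walk.edges_append, SimpleGraph.Walk.edges_cons, List.count_append,
    List.count_cons, List.count_eq_zero_of_not_mem hw₁, List.count_eq_zero_of_not_mem hw₂,
    beq_iff_eq, zero_add, contact]
  exact if_congr Iff.rfl rfl rfl

theorem root_injective : Function.Injective M.root := fun x y h ↦
  M.eq_of_mem (M.root_mem x) (h ▸ M.root_mem y)

variable [Fintype V] {c : Sym2 (ℤ × ℤ) → ZMod 2}

/- The flow of `c` out of the branch set of `x` passes through contacts only. -/
theorem comp_contact_mem_cycleSpace (hc : GridClosed c)
    (hkept : ∀ d ∈ grid.edgeSet, ¬ M.Kept d → c d = 0) : c ∘ M.contact ∈ cycleSpace G := by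
  rw [cycleSpace, LinearMap.mem_ker]
  ext x
  rw [boundary_apply, ← Finset.sum_filter, Pi.zero_apply,
    ← hc.sum_boundary_edges (M.branch x), Finset.sum_sigma']
  refine Finset.sum_of_injOn (M.outDart x) (fun e _ f _ h ↦ ?_) (fun e he ↦ ?_)
    (fun ⟨p, q⟩ hpq hnot ↦ ?_) fun e _ ↦ ?_
  · exact contact_injective (by rw [← mk_outDart x e, h, mk_outDart])
  · exact outDart_mem (Finset.mem_filter.1 he).2
  · simp only [Finset.mem_sigma, Finset.mem_filter, ← grid_adj] at hpq
    obtain ⟨hp, hadj, hq⟩ := hpq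
    refine hkept _ hadj fun h ↦ hnot ?_
    obtain ⟨e, he, heq⟩ := exists_outDart_eq hp hq h
    exact ⟨e, by simpa using he, heq⟩
  · rw [mk_outDart, Function.comp_apply]

theorem gridClosed_sum_walks {y : G.edgeSet → ZMod 2} (hy : y ∈ cycleSpace G)
    (w : ∀ e, grid.Walk (M.root (src e)) (M.root (tgt e))) :
    GridClosed fun d ↦ ∑ e, y e * ((w e).edges.count d : ZMod 2) := by
  intro p
  rw [Finset.sum_comm]
  simp only [← Finset.mul_sum, sum_gridNeighbors_count_edges]
  by_cases hp : ∃ x, p = M.root x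
  · obtain ⟨x, rfl⟩ := hp
    refine Eq.trans (Finset.sum_congr rfl fun e _ ↦ ?_)
      ((boundary_apply y x).symm.trans (congrFun (LinearMap.mem_ker.1 hy) x))
    have hne := src_ne_tgt e
    simp only [root_injective.eq_iff, mem_edge_iff]
    grind
  · push Not at hp
    simp only [hp, if_false, add_zero, mul_zero, Finset.sum_const_zero]

theorem exists_gridClosed_comp_contact {y : G.edgeSet → ZMod 2} (hy : y ∈ cycleSpace G) :
    ∃ c, GridClosed c ∧ (∃ N : ℤ, ∀ p q, p.2 < N → c s(p, q) = 0) ∧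
      (∀ d, ¬ M.Kept d → c d = 0) ∧ c ∘ M.contact = y := by
  choose w hw using M.exists_walk_count_edges
  obtain ⟨N, hN⟩ := exists_forall_count_edges_eq_zero w
  refine ⟨fun d ↦ ∑ e, y e * ((w e).edges.count d : ZMod 2), gridClosed_sum_walks hy w,
    ⟨N, fun p q hp ↦ ?_⟩, fun d hd ↦ ?_, ?_⟩
  · simp only [hN _ p q hp, Nat.cast_zero, mul_zero, Finset.sum_const_zero]
  · obtain ⟨hinner, hcontact⟩ := not_or.1 hd
    refine Finset.sum_eq_zero fun e _ ↦ ?_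
    rw [hw e d hinner, if_neg (not_exists.1 hcontact e), Nat.cast_zero, mul_zero]
  · ext f
    simp only [Function.comp_apply, hw _ _ (not_inner_contact f), contact_injective.eq_iff,
      Nat.cast_ite, Nat.cast_one, Nat.cast_zero, mul_ite, mul_one, mul_zero, Finset.sum_ite_eq',
      Finset.mem_univ, if_true]

variable (M) in
/-- A face of the model: a class of grid cells that can be joined across removed grid edges. -/
def Face : Type :=
  Quot fun a b : ℤ × ℤ ↦
    ∃ d ∈ grid.edgeSet, ¬ M.Kept d ∧ a = upperRightCell d ∧ b = lowerLeftCell d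

theorem hasTwoBasis (M : GridModel G) : HasTwoBasis G := by
  let face : ℤ × ℤ → M.Face := Quot.mk _
  refine hasTwoBasis_of_dual (fun e ↦ face (upperRightCell (M.contact e)))
    (fun e ↦ face (lowerLeftCell (M.contact e))) fun y ↦ ⟨fun hy ↦ ?_, ?_⟩
  · obtain ⟨c, hc, ⟨N, hN⟩, hkept, rfl⟩ := M.exists_gridClosed_comp_contact hy
    obtain ⟨t, ht⟩ := hc.exists_cell_potential hN
    refine ⟨Quot.lift t ?_, fun e ↦ ht _ (M.adj_contact e)⟩
    rintro _ _ ⟨d, hd, hnot, rfl, rfl⟩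
    exact CharTwo.add_eq_zero.1 ((ht d hd).symm.trans (hkept d hnot))
  · rintro ⟨S, hS⟩
    rw [show y = (fun d ↦ S (face (upperRightCell d)) + S (face (lowerLeftCell d))) ∘ M.contact
      from funext hS]
    refine M.comp_contact_mem_cycleSpace (gridClosed_cells (S ∘ face)) fun d hd hnot ↦ ?_
    have hface : face (upperRightCell d) = face (lowerLeftCell d) :=
      Quot.sound ⟨d, hd, hnot, rfl, rfl⟩
    rw [hface, CharTwo.add_self_eq_zero]

end GridModel

end GridModel

section LinkedWalks

variable {V : Type u} {G : SimpleGraph V} {S : Set V} {a b : V}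

theorem linked_image_uIcc {f : ℤ → V} (hf : ∀ n, G.Adj (f n) (f (n + 1))) (m n : ℤ) :
    Linked G (f '' Set.uIcc m n) (f m) (f n) := by
  wlog h : m ≤ n generalizing m n
  · rw [Set.uIcc_comm]
    exact (this n m (le_of_not_ge h)).symm
  rw [Set.uIcc_of_le h]
  induction n, h using Int.leInduction with
  | base => exact .refl ⟨m, by simp⟩
  | succ n hn ih =>
    have hmem : ∀ k ∈ Set.Icc m (n + 1), f k ∈ f '' Set.Icc m (n + 1) := fun k ↦
      Set.mem_image_of_mem f
    exact (ih.mono (Set.image_mono (Set.Icc_subset_Icc_right (by omega)))).trans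
      (.of_adj (hmem n ⟨hn, by omega⟩) (hmem (n + 1) ⟨by omega, le_rfl⟩) (hf n))

theorem Linked.exists_adj_of_notMem_of_mem {B : Set V} (h : Linked G S a b) (ha : a ∉ B)
    (hb : b ∈ B) : ∃ c d, Linked G (S \ B) a c ∧ d ∈ B ∧ G.Adj c d := by
  obtain ⟨w, hw⟩ := h
  induction w with
  | nil => exact absurd hb ha
  | @cons a m b hadj w ih =>
    simp only [SimpleGraph.Walk.support_cons, List.mem_cons, forall_eq_or_imp] at hw
    by_cases hm : m ∈ B
    · exact ⟨a, m, .refl ⟨hw.1, ha⟩, hm, hadj⟩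
    · obtain ⟨c, d, hlink, hd, hcd⟩ := ih hm hb hw.2
      have hstep : Linked G (S \ B) a m := .of_adj ⟨hw.1, ha⟩ ⟨hw.2 m w.start_mem_support, hm⟩ hadj
      exact ⟨c, d, hstep.trans hlink, hd, hcd⟩

theorem Linked.exists_finset (h : Linked G S a b) :
    ∃ T : Finset V, (T : Set V) ⊆ S ∧ b ∈ T ∧ ∀ x ∈ T, Linked G (T : Set V) a x := by
  obtain ⟨w, hw⟩ := h
  refine ⟨w.support.toFinset, fun x hx ↦ hw x (by simpa using hx), by simp, fun x hx ↦ ?_⟩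
  have hx' := List.mem_toFinset.1 hx
  exact ⟨w.takeUntil x hx', fun y hy ↦ by
    simpa using w.support_takeUntil_subset_support hx' hy⟩

end LinkedWalks

section Rounding

variable {η r : ℝ} {P Q : ℝ × ℝ}

theorem linked_grid_uIcc (p q : ℤ × ℤ) : Linked grid (Set.uIcc p q) p q := by
  have hrow := linked_image_uIcc (G := grid) (f := fun n ↦ (n, p.2))
    (fun n ↦ grid_adj.2 (mem_gridNeighbors.2 (.inl rfl))) p.1 q.1
  have hcol := linked_image_uIcc (G := grid) (f := fun n ↦ (q.1, n))
    (fun n ↦ grid_adj.2 (mem_gridNeighbors.2 (.inr (.inr (.inl rfl))))) p.2 q.2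
  rw [Set.uIcc_prod_eq]
  refine (hrow.mono ?_).trans (hcol.mono ?_)
  · rintro _ ⟨n, hn, rfl⟩
    exact ⟨hn, Set.left_mem_uIcc⟩
  · rintro _ ⟨n, hn, rfl⟩
    exact ⟨Set.right_mem_uIcc, hn⟩

/-- The point of the plane with given grid coordinates, for mesh `η`. -/
def gridPoint (η : ℝ) (p : ℤ × ℤ) : ℝ × ℝ := (η * p.1, η * p.2)

/-- The lower left corner of the grid cell of mesh `η` that contains a given point. -/
noncomputable def roundDown (η : ℝ) (P : ℝ × ℝ) : ℤ × ℤ := (⌊P.1 / η⌋, ⌊P.2 / η⌋)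

theorem abs_mul_floor_div_sub_le (hη : 0 < η) (x : ℝ) : |η * ⌊x / η⌋ - x| ≤ η := by
  have hle := (le_div_iff₀ hη).1 (Int.floor_le (x / η))
  have hlt := (div_lt_iff₀ hη).1 (Int.lt_floor_add_one (x / η))
  rw [abs_le]
  constructor <;> linarith

theorem dist_gridPoint_roundDown_le (hη : 0 < η) (P : ℝ × ℝ) :
    dist (gridPoint η (roundDown η P)) P ≤ η :=
  max_le (abs_mul_floor_div_sub_le hη _) (abs_mul_floor_div_sub_le hη _)

/-- The grid points of mesh `η` at distance at most `r` from `P`, in the maximum norm. -/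
noncomputable def gridBox (η r : ℝ) (P : ℝ × ℝ) : Finset (ℤ × ℤ) :=
  Finset.Icc (⌈(P.1 - r) / η⌉, ⌈(P.2 - r) / η⌉) (⌊(P.1 + r) / η⌋, ⌊(P.2 + r) / η⌋)

theorem mem_gridBox (hη : 0 < η) {p : ℤ × ℤ} :
    p ∈ gridBox η r P ↔ dist (gridPoint η p) P ≤ r := by
  simp only [Prod.dist_eq, max_le_iff, Real.dist_eq, abs_le, gridBox, Finset.mem_Icc,
    Prod.le_def, Int.ceil_le, Int.le_floor, div_le_iff₀ hη, le_div_iff₀ hη, gridPoint]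
  grind

theorem linked_gridBox {p q : ℤ × ℤ} (hp : p ∈ gridBox η r P) (hq : q ∈ gridBox η r P) :
    Linked grid (gridBox η r P : Set (ℤ × ℤ)) p q := by
  refine (linked_grid_uIcc p q).mono ?_
  rw [gridBox, Finset.coe_Icc]
  exact Set.uIcc_subset_Icc (Finset.mem_Icc.1 hp) (Finset.mem_Icc.1 hq)

theorem linked_roundDown (hη : 0 < η) (h : dist Q P ≤ η) :
    Linked grid (gridBox η (2 * η) P : Set (ℤ × ℤ)) (roundDown η P) (roundDown η Q) := by
  have hP := dist_gridPoint_roundDown_le hη P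
  have hQ := dist_gridPoint_roundDown_le hη Q
  have htri := dist_triangle (gridPoint η (roundDown η Q)) Q P
  exact linked_gridBox ((mem_gridBox hη).2 (by linarith)) ((mem_gridBox hη).2 (by linarith))

/-- The grid points of mesh `η` at distance at most `2 * η` from a curve. -/
def gridTube (η : ℝ) {T : Type*} (γ : T → ℝ × ℝ) : Set (ℤ × ℤ) :=
  {p | ∃ t, dist (gridPoint η p) (γ t) ≤ 2 * η}

theorem linked_gridTube (hη : 0 < η) {T : Type*} [TopologicalSpace T] [PreconnectedSpace T]
    {γ : T → ℝ × ℝ} (hγ : Continuous γ) (t t' : T) :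
    Linked grid (gridTube η γ) (roundDown η (γ t)) (roundDown η (γ t')) := by
  let joined : T → T → Prop := fun t t' ↦
    Linked grid (gridTube η γ) (roundDown η (γ t)) (roundDown η (γ t'))
  have : Std.Symm joined := ⟨fun _ _ h ↦ h.symm⟩
  refine PreconnectedSpace.induction₂ joined (fun t ↦ ?_) ⟨fun _ _ _ h h' ↦ h.trans h'⟩ t t'
  filter_upwards [Metric.tendsto_nhds.1 (hγ.tendsto t) η hη] with t' ht'
  exact (linked_roundDown hη ht'.le).mono fun p hp ↦
    ⟨t, (mem_gridBox hη).1 (Finset.mem_coe.1 hp)⟩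

end Rounding

section Separation

open Filter Topology

theorem eventually_mul_lt {c δ : ℝ} (hδ : 0 < δ) : ∀ᶠ r in 𝓝[>] (0 : ℝ), c * r < δ := by
  have hlim : Tendsto (fun r : ℝ ↦ c * r) (𝓝 0) (𝓝 0) :=
    (continuous_const_mul c).tendsto' 0 0 (mul_zero c)
  exact nhdsWithin_le_nhds (hlim.eventually_lt_const hδ)

theorem eventually_forall_mul_lt_dist {X : Type*} [PseudoMetricSpace X] {K L : Set X}
    (hK : IsCompact K) (hL : IsClosed L) (hKL : Disjoint K L) (c : ℝ) :
    ∀ᶠ r in 𝓝[>] (0 : ℝ), ∀ a ∈ K, ∀ b ∈ L, c * r < dist a b := by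
  obtain ⟨δ, hδ, hdist⟩ := Metric.exists_pos_forall_lt_edist hK hL hKL
  filter_upwards [eventually_mul_lt (c := c) (NNReal.coe_pos.2 hδ)] with r hr a ha b hb
  refine hr.trans ?_
  have hab := hdist a ha b hb
  rw [edist_nndist, ENNReal.coe_lt_coe] at hab
  exact_mod_cast hab

end Separation

section Drawings

open Filter Topology

variable {V : Type u} {G : SimpleGraph V}

/-- A plane drawing with parametrized edges, in the coordinate plane `ℝ × ℝ` (which carries the
maximum norm, so that balls are squares). -/
structure CurveDrawing (G : SimpleGraph V) where
  /-- the point representing a vertex -/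
  point : V → ℝ × ℝ
  /-- the curve representing an edge -/
  curve : ∀ e : G.edgeSet, Path (point (src e)) (point (tgt e))
  point_injective : Function.Injective point
  mem_of_curve_eq_point : ∀ {e : G.edgeSet} {t x}, curve e t = point x → x ∈ (e : Sym2 V)
  exists_point_of_curve_eq_curve : ∀ {e f : G.edgeSet} {s t}, e ≠ f → curve e s = curve f t →
    ∃ x, curve e s = point x

theorem PlaneDrawing.nonempty_curveDrawing (D : PlaneDrawing G) : Nonempty (CurveDrawing G) := by
  let coords : EuclideanSpace ℝ (Fin 2) ≃ₜ ℝ × ℝ :=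
    (EuclideanSpace.equiv (Fin 2) ℝ).toHomeomorph.trans Homeomorph.finTwoArrow
  have hcurve : ∀ e : G.edgeSet, ∃ γ : Path (D.point (src e)) (D.point (tgt e)),
      ∀ t, γ t ∈ D.arc e := fun e ↦ by
    obtain ⟨γ, -, hγ⟩ := D.arc_eq _ _ (adj_src_tgt e)
    rw [mk_src_tgt] at hγ
    exact ⟨γ, fun t ↦ hγ ▸ Set.mem_range_self t⟩
  choose γ hγ using hcurve
  refine ⟨⟨coords ∘ D.point, fun e ↦ (γ e).map coords.continuous,
    coords.injective.comp D.point_injective, fun {e t x} h ↦ ?_, fun {e f s t} hef h ↦ ?_⟩⟩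
  · exact D.vertex_on_arc e e.2 x (coords.injective h ▸ hγ e t)
  · obtain ⟨x, -, -, hx⟩ := D.arc_inter_arc e e.2 f f.2 (Subtype.coe_ne_coe.2 hef) (γ e s)
      ⟨hγ e s, coords.injective h ▸ hγ f t⟩
    exact ⟨x, congrArg coords hx⟩

/-- A drawing together with a radius for the vertices and a much smaller mesh for the edges such
that the thickened vertices and edges stay apart as the vertices and edges themselves do. -/
structure FatDrawing (G : SimpleGraph V) extends CurveDrawing G where
  /-- the radius of a thickened vertex -/
  radius : ℝ
  /-- the mesh of the grid -/
  mesh : ℝ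
  mesh_pos : 0 < mesh
  four_mul_mesh_lt_radius : 4 * mesh < radius
  lt_dist_point : ∀ {x y}, x ≠ y → 2 * radius < dist (point x) (point y)
  lt_dist_curve : ∀ {x} {e : G.edgeSet}, x ∉ (e : Sym2 V) →
    ∀ t, 2 * radius < dist (curve e t) (point x)
  lt_dist_curve_curve : ∀ {e f : G.edgeSet} {s t}, e ≠ f →
    (∀ x, radius / 2 ≤ dist (curve e s) (point x)) →
    (∀ x, radius / 2 ≤ dist (curve f t) (point x)) → 4 * mesh < dist (curve e s) (curve f t)

namespace CurveDrawing

variable [Finite V] (D : CurveDrawing G)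

theorem eventually_lt_dist_point :
    ∀ᶠ r in 𝓝[>] (0 : ℝ), ∀ x y, x ≠ y → 2 * r < dist (D.point x) (D.point y) := by
  simp only [eventually_all]
  intro x y hxy
  have hdisj : Disjoint {D.point x} {D.point y} :=
    Set.disjoint_singleton.2 (D.point_injective.ne hxy)
  filter_upwards [eventually_forall_mul_lt_dist isCompact_singleton isClosed_singleton hdisj 2]
    with r hr using hr _ rfl _ rfl

theorem eventually_lt_dist_curve :
    ∀ᶠ r in 𝓝[>] (0 : ℝ), ∀ (x) (e : G.edgeSet), x ∉ (e : Sym2 V) →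
      ∀ t, 2 * r < dist (D.curve e t) (D.point x) := by
  simp only [eventually_all]
  intro x e hx
  have hdisj : Disjoint (Set.range (D.curve e)) {D.point x} := by
    rw [Set.disjoint_singleton_right]
    rintro ⟨t, ht⟩
    exact hx (D.mem_of_curve_eq_point ht)
  filter_upwards [eventually_forall_mul_lt_dist (isCompact_range (D.curve e).continuous)
    isClosed_singleton hdisj 2] with r hr t using hr _ ⟨t, rfl⟩ _ rfl

theorem eventually_lt_dist_curve_curve {r : ℝ} (hr : 0 < r) :
    ∀ᶠ η in 𝓝[>] (0 : ℝ), ∀ e f, e ≠ f → ∀ s t, (∀ x, r ≤ dist (D.curve e s) (D.point x)) →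
      (∀ x, r ≤ dist (D.curve f t) (D.point x)) →
      4 * η < dist (D.curve e s) (D.curve f t) := by
  simp only [eventually_all]
  intro e f hef
  let far : Set (ℝ × ℝ) := ⋂ x, {P | r ≤ dist P (D.point x)}
  have hfar : IsClosed far := isClosed_iInter fun x ↦
    isClosed_le continuous_const (continuous_id.dist continuous_const)
  have hcompact : ∀ e, IsCompact (Set.range (D.curve e) ∩ far) := fun e ↦
    (isCompact_range (D.curve e).continuous).inter_right hfar
  have hdisj : Disjoint (Set.range (D.curve e) ∩ far) (Set.range (D.curve f) ∩ far) := by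
    rw [Set.disjoint_left]
    rintro _ ⟨⟨s, rfl⟩, hs⟩ ⟨⟨t, ht⟩, -⟩
    obtain ⟨x, hx⟩ := D.exists_point_of_curve_eq_curve hef ht.symm
    have hle : r ≤ dist (D.curve e s) (D.point x) := Set.mem_iInter.1 hs x
    rw [hx, dist_self] at hle
    exact hle.not_gt hr
  filter_upwards [eventually_forall_mul_lt_dist (hcompact e) (hcompact f).isClosed hdisj 4]
    with η hη s t hs ht
  exact hη _ ⟨⟨s, rfl⟩, Set.mem_iInter.2 hs⟩ _ ⟨⟨t, rfl⟩, Set.mem_iInter.2 ht⟩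

theorem nonempty_fatDrawing (D : CurveDrawing G) : Nonempty (FatDrawing G) := by
  obtain ⟨r, ⟨hpoint, hcurve⟩, hr : 0 < r⟩ :=
    ((D.eventually_lt_dist_point.and D.eventually_lt_dist_curve).and self_mem_nhdsWithin).exists
  obtain ⟨η, ⟨hcurves, hηr⟩, hη⟩ := (((D.eventually_lt_dist_curve_curve (half_pos hr)).and
    (eventually_mul_lt hr)).and self_mem_nhdsWithin).exists
  exact ⟨{ D with
    radius := r
    mesh := η
    mesh_pos := hη
    four_mul_mesh_lt_radius := hηr
    lt_dist_point := hpoint _ _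
    lt_dist_curve := hcurve _ _
    lt_dist_curve_curve := fun hef ↦ hcurves _ _ hef _ _ }⟩

end CurveDrawing

end Drawings

section FatDrawing

variable {V : Type u} {G : SimpleGraph V}

namespace FatDrawing

variable (D : FatDrawing G)

/-- The grid square around a vertex. -/
noncomputable def box (x : V) : Finset (ℤ × ℤ) := gridBox D.mesh D.radius (D.point x)

/-- The grid point that represents a vertex. -/
noncomputable def center (x : V) : ℤ × ℤ := roundDown D.mesh (D.point x)

/-- A part of the thickened edge `e` that joins the box of its initial vertex to the box of its
terminal vertex without entering the latter. -/
structure Tentacle (e : G.edgeSet) where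
  /-- the grid points of the tentacle -/
  carrier : Finset (ℤ × ℤ)
  /-- the last point of the tentacle -/
  tip : ℤ × ℤ
  /-- the point of the box of the terminal vertex that the tentacle touches -/
  target : ℤ × ℤ
  mem_gridTube : ∀ {p}, p ∈ carrier → p ∈ gridTube D.mesh (D.curve e)
  notMem_box_tgt : ∀ {p}, p ∈ carrier → p ∉ D.box (tgt e)
  linked : ∀ {p}, p ∈ carrier → Linked grid (carrier : Set (ℤ × ℤ)) (D.center (src e)) p
  tip_mem : tip ∈ carrier
  target_mem : target ∈ D.box (tgt e)
  adj : grid.Adj tip target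

variable {D} {x y : V} {e f : G.edgeSet} {p : ℤ × ℤ}

theorem mem_box : p ∈ D.box x ↔ dist (gridPoint D.mesh p) (D.point x) ≤ D.radius :=
  mem_gridBox D.mesh_pos

theorem center_mem_box : D.center x ∈ D.box x :=
  mem_box.2 ((dist_gridPoint_roundDown_le D.mesh_pos _).trans
    (by linarith [D.mesh_pos, D.four_mul_mesh_lt_radius]))

theorem eq_of_mem_box (hx : p ∈ D.box x) (hy : p ∈ D.box y) : x = y := by
  by_contra hxy
  rw [mem_box] at hx hy
  have hlt := D.lt_dist_point hxy
  have htri := dist_triangle_left (D.point x) (D.point y) (gridPoint D.mesh p)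
  linarith

theorem nonempty_tentacle (e : G.edgeSet) : Nonempty (D.Tentacle e) := by
  have hlink := linked_gridTube D.mesh_pos (D.curve e).continuous 0 1
  rw [(D.curve e).source, (D.curve e).target] at hlink
  obtain ⟨c, d, hc, hd, hcd⟩ := hlink.exists_adj_of_notMem_of_mem (B := (D.box (tgt e) : Set _))
    (fun h ↦ src_ne_tgt e (eq_of_mem_box center_mem_box h)) center_mem_box
  obtain ⟨T, hsub, hcT, hT⟩ := hc.exists_finset
  exact ⟨⟨T, c, d, fun hp ↦ (hsub hp).1, fun hp ↦ (hsub hp).2, hT _, hcT, hd, hcd⟩⟩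

theorem Tentacle.eq_src_of_mem_box (T : D.Tentacle e) (hp : p ∈ T.carrier) (hx : p ∈ D.box x) :
    x = src e := by
  by_contra hsrc
  have htgt : x ≠ tgt e := by
    rintro rfl
    exact T.notMem_box_tgt hp hx
  obtain ⟨t, ht⟩ := T.mem_gridTube hp
  have hlt := D.lt_dist_curve (x := x) (e := e) (by simp [mem_edge_iff, hsrc, htgt]) t
  have htri := dist_triangle_left (D.curve e t) (D.point x) (gridPoint D.mesh p)
  rw [mem_box] at hx
  linarith [D.mesh_pos, D.four_mul_mesh_lt_radius]

theorem half_radius_le_dist (hp : p ∉ D.box x) {P : ℝ × ℝ}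
    (hP : dist (gridPoint D.mesh p) P ≤ 2 * D.mesh) : D.radius / 2 ≤ dist P (D.point x) := by
  rw [mem_box, not_le] at hp
  have htri := dist_triangle (gridPoint D.mesh p) P (D.point x)
  linarith [D.four_mul_mesh_lt_radius]

theorem Tentacle.src_eq_src (T : D.Tentacle e) (T' : D.Tentacle f) (hp : p ∈ T.carrier)
    (hp' : p ∈ T'.carrier) : src e = src f := by
  by_contra hne
  have hbox : ∀ x, p ∉ D.box x := fun x hx ↦
    hne ((T.eq_src_of_mem_box hp hx).symm.trans (T'.eq_src_of_mem_box hp' hx))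
  obtain ⟨s, hs⟩ := T.mem_gridTube hp
  obtain ⟨t, ht⟩ := T'.mem_gridTube hp'
  have hlt := D.lt_dist_curve_curve (ne_of_apply_ne src hne)
    (fun x ↦ half_radius_le_dist (hbox x) hs) (fun x ↦ half_radius_le_dist (hbox x) ht)
  have htri := dist_triangle_left (D.curve e s) (D.curve f t) (gridPoint D.mesh p)
  linarith

/-- A choice of a tentacle for every edge. -/
noncomputable def tentacle (D : FatDrawing G) (e : G.edgeSet) : D.Tentacle e :=
  (nonempty_tentacle e).some

variable [Fintype V]

variable (D) in
/-- The box of a vertex together with the tentacles of the edges that leave it. -/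
noncomputable def branch (x : V) : Finset (ℤ × ℤ) :=
  D.box x ∪ ({e | src e = x} : Finset G.edgeSet).biUnion fun e ↦ (D.tentacle e).carrier

theorem mem_branch :
    p ∈ D.branch x ↔ p ∈ D.box x ∨ ∃ e, src e = x ∧ p ∈ (D.tentacle e).carrier := by
  simp [branch]

theorem eq_of_mem_branch (hx : p ∈ D.branch x) (hy : p ∈ D.branch y) : x = y := by
  rcases mem_branch.1 hx with hx' | ⟨e, rfl, he⟩ <;>
    rcases mem_branch.1 hy with hy' | ⟨f, rfl, hf⟩
  exacts [eq_of_mem_box hx' hy', (D.tentacle f).eq_src_of_mem_box hf hx',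
    ((D.tentacle e).eq_src_of_mem_box he hy').symm, (D.tentacle e).src_eq_src _ he hf]

theorem linked_branch (hp : p ∈ D.branch x) :
    Linked grid (D.branch x : Set (ℤ × ℤ)) (D.center x) p := by
  rcases mem_branch.1 hp with hbox | ⟨e, rfl, he⟩
  · exact (linked_gridBox center_mem_box hbox).mono fun q hq ↦ mem_branch.2 (.inl hq)
  · exact ((D.tentacle e).linked he).mono fun q hq ↦ mem_branch.2 (.inr ⟨e, rfl, hq⟩)

variable (D) in
/-- The grid model obtained from a fat drawing. -/
noncomputable def gridModel : GridModel G where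
  branch := D.branch
  root := D.center
  contactSrc e := (D.tentacle e).tip
  contactTgt e := (D.tentacle e).target
  eq_of_mem := eq_of_mem_branch
  root_mem _ := mem_branch.2 (.inl center_mem_box)
  linked := linked_branch
  contactSrc_mem e := mem_branch.2 (.inr ⟨e, rfl, (D.tentacle e).tip_mem⟩)
  contactTgt_mem e := mem_branch.2 (.inl (D.tentacle e).target_mem)
  adj_contact e := (D.tentacle e).adj

end FatDrawing

theorem IsPlanar.hasTwoBasis [Fintype V] (h : IsPlanar G) : HasTwoBasis G := by
  obtain ⟨D⟩ := h
  obtain ⟨D'⟩ := D.nonempty_curveDrawing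
  obtain ⟨F⟩ := D'.nonempty_fatDrawing
  exact F.gridModel.hasTwoBasis

end FatDrawing

section Induce

variable {V : Type u} {G : SimpleGraph V}

theorem IsPlanar.induce (h : IsPlanar G) (s : Set V) : IsPlanar (G.induce s) := by
  obtain ⟨D⟩ := h
  have hedge : ∀ e ∈ (G.induce s).edgeSet, e.map Subtype.val ∈ G.edgeSet :=
    Sym2.ind fun _ _ h ↦ h
  refine ⟨⟨fun x ↦ D.point x, fun e ↦ D.arc (e.map Subtype.val), ?_, ?_, ?_, ?_⟩⟩
  · exact fun x y h ↦ Subtype.ext (D.point_injective h)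
  · exact fun x y h ↦ D.arc_eq x y h
  · intro e he x hx
    obtain ⟨y, hy, hxy⟩ := Sym2.mem_map.1 (D.vertex_on_arc _ (hedge e he) x hx)
    rwa [← Subtype.ext hxy]
  · intro e he f hf hef p hp
    obtain ⟨x, hxe, hxf, rfl⟩ := D.arc_inter_arc _ (hedge e he) _ (hedge f hf)
      ((Sym2.map.injective Subtype.val_injective).ne hef) p hp
    obtain ⟨y, hy, rfl⟩ := Sym2.mem_map.1 hxe
    obtain ⟨y', hy', hyy'⟩ := Sym2.mem_map.1 hxf
    rw [Subtype.ext hyy'] at hy'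
    exact ⟨y, hy, hy', rfl⟩

theorem degree_induce_coe (Z : Finset V) (x : (Z : Set V)) :
    (G.induce (Z : Set V)).degree x = (Z.filter (G.Adj x)).card := by
  rw [← SimpleGraph.card_neighborFinset_eq_degree, ← Finset.card_map (Function.Embedding.subtype _)]
  congr 1
  ext y
  simp [and_comm]

theorem IsPlanar.exists_light_configuration (hP : IsPlanar G) (hC : NoFourCycle G)
    {Z : Finset V} (hZ : Z.Nonempty) :
    (∃ x ∈ Z, (Z.filter (G.Adj x)).card ≤ 3) ∨
      ∃ H ⊆ Z, G.IsNClique 3 H ∧ ∀ u ∈ H, (Z.filter (G.Adj u)).card = 4 := by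
  have : Nonempty (Z : Set V) := hZ.to_subtype
  have hCZ := hC.induce (Z : Set V)
  have hbound := (hP.induce (Z : Set V)).hasTwoBasis.edge_bound hCZ
  rcases Flexibility.exists_light_configuration hCZ hbound with ⟨x, hx⟩ | ⟨T, hT, hdeg⟩
  · exact .inl ⟨x, x.2, degree_induce_coe Z x ▸ hx⟩
  · refine .inr ⟨T.map (Function.Embedding.subtype _), ?_,
      (hT.map (f := Function.Embedding.subtype _)).mono (SimpleGraph.map_comap_le _ _), ?_⟩
    · exact fun u hu ↦ Finset.property_of_mem_map_subtype T hu
    · simp only [Finset.mem_map]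
      rintro _ ⟨u, hu, rfl⟩
      exact degree_induce_coe Z u ▸ hdeg u hu

end Induce

section Reducible

variable {V : Type u} {C : Type v} {G : SimpleGraph V} {L : V → Finset C} {Z H : Finset V}
  {N d : ℕ} {ψ ψ' : V → C} {x : V} {c : C}

/-- A map that is an `L`-coloring of the subgraph induced by `Z`; its values outside `Z` are
arbitrary. -/
def IsListColoringOn (G : SimpleGraph V) (L : V → Finset C) (Z : Finset V) (ψ : V → C) : Prop :=
  ∀ x ∈ Z, ψ x ∈ L x ∧ ∀ y ∈ Z, G.Adj x y → ψ x ≠ ψ y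

/-- The map `ψ'` arises from `ψ` by recoloring `H` from the lists without creating a conflict
between `H` and `Z`. -/
def Recolors (G : SimpleGraph V) (L : V → Finset C) (Z H : Finset V) (ψ ψ' : V → C) : Prop :=
  (∀ u ∉ H, ψ' u = ψ u) ∧ ∀ u ∈ H, ψ' u ∈ L u ∧ ∀ v ∈ Z, G.Adj u v → ψ' u ≠ ψ' v

theorem Recolors.isListColoringOn (h : Recolors G L Z H ψ ψ')
    (hψ : IsListColoringOn G L (Z \ H) ψ) : IsListColoringOn G L Z ψ' := by
  intro x hx
  by_cases hxH : x ∈ H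
  · exact h.2 x hxH
  obtain ⟨hxL, hadj⟩ := hψ x (Finset.mem_sdiff.2 ⟨hx, hxH⟩)
  refine ⟨h.1 x hxH ▸ hxL, fun y hy hxy ↦ ?_⟩
  by_cases hyH : y ∈ H
  · exact ((h.2 y hyH).2 x hx hxy.symm).symm
  · rw [h.1 x hxH, h.1 y hyH]
    exact hadj y (Finset.mem_sdiff.2 ⟨hy, hyH⟩) hxy

/-- The colors of `L x` not used by `ψ` on the neighbors of `x` in `Y`. -/
noncomputable def available (G : SimpleGraph V) (L : V → Finset C) (Y : Finset V) (ψ : V → C)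
    (x : V) : Finset C := L x \ (Y.filter (G.Adj x)).image ψ

theorem mem_available {Y : Finset V} :
    c ∈ available G L Y ψ x ↔ c ∈ L x ∧ ∀ u ∈ Y, G.Adj x u → ψ u ≠ c := by
  simp [available]

theorem card_le_card_available_add (Y : Finset V) (ψ : V → C) (x : V) :
    (L x).card ≤ (available G L Y ψ x).card + (Y.filter (G.Adj x)).card := by
  have hsdiff := Finset.le_card_sdiff ((Y.filter (G.Adj x)).image ψ) (L x)
  have himage : ((Y.filter (G.Adj x)).image ψ).card ≤ (Y.filter (G.Adj x)).card :=
    Finset.card_image_le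
  rw [available]
  omega

theorem recolors_piecewise {f : V → C} (hf : Set.InjOn f H)
    (hfS : ∀ u ∈ H, f u ∈ available G L (Z \ H) ψ u) : Recolors G L Z H ψ (H.piecewise f ψ) := by
  refine ⟨fun u hu ↦ Finset.piecewise_eq_of_notMem H f ψ hu, fun u hu ↦ ?_⟩
  rw [Finset.piecewise_eq_of_mem H f ψ hu]
  obtain ⟨hL, hψ⟩ := mem_available.1 (hfS u hu)
  refine ⟨hL, fun v hv huv ↦ ?_⟩
  by_cases hvH : v ∈ H
  · rw [Finset.piecewise_eq_of_mem H f ψ hvH]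
    exact hf.ne hu hvH huv.ne
  · rw [Finset.piecewise_eq_of_notMem H f ψ hvH]
    exact (hψ v (Finset.mem_sdiff.2 ⟨hv, hvH⟩) huv).symm

theorem exists_recolors_of_hall {S : V → Finset C}
    (hS : ∀ u ∈ H, S u ⊆ available G L (Z \ H) ψ u)
    (hall : ∀ J ⊆ H, J.Nonempty → ∃ u ∈ J, J.card ≤ (S u).card) :
    ∃ ψ', Recolors G L Z H ψ ψ' ∧ ∀ u ∈ H, ψ' u ∈ S u := by
  have hcond : ∀ J : Finset H, J.card ≤ (J.biUnion fun u ↦ S u).card := by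
    intro J
    rcases J.eq_empty_or_nonempty with rfl | hJ
    · simp
    obtain ⟨u, hu, hle⟩ := hall (J.map (Function.Embedding.subtype _))
      (fun u hu ↦ Finset.property_of_mem_map_subtype J hu) (hJ.map)
    obtain ⟨u, huJ, rfl⟩ := Finset.mem_map.1 hu
    rw [Finset.card_map] at hle
    exact hle.trans (Finset.card_le_card (Finset.subset_biUnion_of_mem (fun u : H ↦ S u) huJ))
  obtain ⟨g, hg, hgS⟩ := (Finset.all_card_le_biUnion_card_iff_exists_injective _).1 hcond
  let f : V → C := fun u ↦ if hu : u ∈ H then g ⟨u, hu⟩ else ψ u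
  have hf : ∀ u (hu : u ∈ H), f u = g ⟨u, hu⟩ := fun u hu ↦ dif_pos hu
  have hfS : ∀ u ∈ H, f u ∈ S u := fun u hu ↦ hf u hu ▸ hgS ⟨u, hu⟩
  refine ⟨H.piecewise f ψ, recolors_piecewise (fun u hu v hv huv ↦ ?_)
    (fun u hu ↦ hS u hu (hfS u hu)), fun u hu ↦ ?_⟩
  · rw [hf u hu, hf v hv] at huv
    exact congrArg Subtype.val (hg huv)
  · rw [Finset.piecewise_eq_of_mem H f ψ hu]
    exact hfS u hu

theorem exists_recolors_fix (hcard : ∀ u ∈ H, H.card ≤ (available G L (Z \ H) ψ u).card)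
    (hc : c ∈ available G L (Z \ H) ψ x) (hx : x ∈ H) :
    ∃ ψ', Recolors G L Z H ψ ψ' ∧ ψ' x = c := by
  let S : V → Finset C := fun u ↦ if u = x then {c} else available G L (Z \ H) ψ u
  have hSx : S x = {c} := if_pos rfl
  have hSne : ∀ u, u ≠ x → S u = available G L (Z \ H) ψ u := fun u hu ↦ if_neg hu
  have hS : ∀ u ∈ H, S u ⊆ available G L (Z \ H) ψ u := fun u _ ↦ by
    by_cases hu : u = x
    · simpa [hu, hSx] using hc
    · exact (hSne u hu).subset
  have hall : ∀ J ⊆ H, J.Nonempty → ∃ u ∈ J, J.card ≤ (S u).card := fun J hJ hne ↦ by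
    by_cases hJx : ∃ u ∈ J, u ≠ x
    · obtain ⟨u, hu, hux⟩ := hJx
      exact ⟨u, hu, hSne u hux ▸ (Finset.card_le_card hJ).trans (hcard u (hJ hu))⟩
    · push Not at hJx
      obtain rfl : J = {x} := Finset.eq_singleton_iff_nonempty_unique_mem.2 ⟨hne, hJx⟩
      exact ⟨x, by simp, by simp [hSx]⟩
  obtain ⟨ψ', hψ', hmem⟩ := exists_recolors_of_hall hS hall
  exact ⟨ψ', hψ', Finset.mem_singleton.1 (hSx ▸ hmem x hx)⟩

theorem exists_recolors_forbid {J : Finset V}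
    (hcard : ∀ u ∈ H, H.card ≤ (available G L (Z \ H) ψ u).card)
    (hJ : H ⊆ J → ∃ u ∈ H, H.card < (available G L (Z \ H) ψ u).card) (c : C) :
    ∃ ψ', Recolors G L Z H ψ ψ' ∧ ∀ u ∈ H ∩ J, ψ' u ≠ c := by
  let S : V → Finset C := fun u ↦
    if u ∈ J then (available G L (Z \ H) ψ u).erase c else available G L (Z \ H) ψ u
  have hSmem : ∀ u ∈ J, S u = (available G L (Z \ H) ψ u).erase c := fun u hu ↦ if_pos hu
  have hSnotMem : ∀ u ∉ J, S u = available G L (Z \ H) ψ u := fun u hu ↦ if_neg hu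
  have hS : ∀ u ∈ H, S u ⊆ available G L (Z \ H) ψ u := fun u _ ↦ by
    by_cases hu : u ∈ J
    · exact hSmem u hu ▸ Finset.erase_subset _ _
    · exact (hSnotMem u hu).subset
  have hScard : ∀ u, (available G L (Z \ H) ψ u).card ≤ (S u).card + 1 := fun u ↦ by
    by_cases hu : u ∈ J
    · exact hSmem u hu ▸ Nat.sub_le_iff_le_add.1 Finset.pred_card_le_card_erase
    · exact hSnotMem u hu ▸ Nat.le_succ _
  have hall : ∀ K ⊆ H, K.Nonempty → ∃ u ∈ K, K.card ≤ (S u).card := fun K hK hne ↦ by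
    rcases hK.eq_or_ssubset with rfl | hlt
    · by_cases hKJ : K ⊆ J
      · obtain ⟨u, hu, hlt⟩ := hJ hKJ
        exact ⟨u, hu, Nat.le_of_lt_succ (hlt.trans_le (hScard u))⟩
      · obtain ⟨u, hu, huJ⟩ := Finset.not_subset.1 hKJ
        exact ⟨u, hu, hSnotMem u huJ ▸ hcard u hu⟩
    · obtain ⟨u, hu⟩ := hne
      have hKH := Finset.card_lt_card hlt
      exact ⟨u, hu, Nat.le_of_lt_succ (hKH.trans_le ((hcard u (hK hu)).trans (hScard u)))⟩
  obtain ⟨ψ', hψ', hmem⟩ := exists_recolors_of_hall hS hall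
  refine ⟨ψ', hψ', fun u hu ↦ ?_⟩
  rw [Finset.mem_inter] at hu
  exact Finset.ne_of_mem_erase (hSmem u hu.2 ▸ hmem u hu.1)

/-- A nonempty set `H ⊆ Z` that can be recolored in at most `N` ways, whose vertices have at most
`d` neighbors in `Z \ H`, and such that every map can be recolored on `H`, both with a prescribed
color at one vertex, as long as its neighbors in `Z \ H` avoid that color, and with a color
forbidden at all neighbors in `H` of some vertex outside `Z`. -/
structure Reducible (G : SimpleGraph V) (L : V → Finset C) (N d : ℕ) (Z H : Finset V) :
    Prop where
  subset : H ⊆ Z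
  nonempty : H.Nonempty
  prod_card_le : ∏ u ∈ H, (L u).card ≤ N
  outer_degree_le : ∀ x ∈ H, ((Z \ H).filter (G.Adj x)).card ≤ d
  extend : ∀ ψ : V → C, ∃ ψ', Recolors G L Z H ψ ψ'
  fix : ∀ (ψ : V → C), ∀ x ∈ H, ∀ c ∈ L x, (∀ u ∈ Z \ H, G.Adj x u → ψ u ≠ c) →
    ∃ ψ', Recolors G L Z H ψ ψ' ∧ ψ' x = c
  forbid : ∀ (ψ : V → C) (c : C), ∀ y ∉ Z, ∃ ψ', Recolors G L Z H ψ ψ' ∧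
    ∀ u ∈ H, G.Adj y u → ψ' u ≠ c

theorem reducible_of_card (hHZ : H ⊆ Z) (hne : H.Nonempty) (hN : ∏ u ∈ H, (L u).card ≤ N)
    (hd : ∀ u ∈ H, ((Z \ H).filter (G.Adj u)).card ≤ d)
    (hcard : ∀ u ∈ H, ((Z \ H).filter (G.Adj u)).card + H.card ≤ (L u).card)
    (hstrict : ∀ y ∉ Z, (∀ u ∈ H, G.Adj y u) →
      ∃ u ∈ H, ((Z \ H).filter (G.Adj u)).card + H.card < (L u).card) :
    Reducible G L N d Z H := by
  have hav : ∀ ψ : V → C, ∀ u ∈ H, H.card ≤ (available G L (Z \ H) ψ u).card := fun ψ u hu ↦ by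
    have := card_le_card_available_add (G := G) (L := L) (Z \ H) ψ u
    have := hcard u hu
    omega
  refine ⟨hHZ, hne, hN, hd, fun ψ ↦ ?_, fun ψ x hx c hc hψ ↦ ?_, fun ψ c y hy ↦ ?_⟩
  · obtain ⟨ψ', hψ', -⟩ := exists_recolors_of_hall (fun _ _ ↦ subset_rfl)
      fun J hJ ⟨u, hu⟩ ↦ ⟨u, hu, (Finset.card_le_card hJ).trans (hav ψ u (hJ hu))⟩
    exact ⟨ψ', hψ'⟩
  · exact exists_recolors_fix (hav ψ) (mem_available.2 ⟨hc, hψ⟩) hx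
  · have hall : H ⊆ H.filter (G.Adj y) →
        ∃ u ∈ H, H.card < (available G L (Z \ H) ψ u).card := fun hHy ↦ by
      obtain ⟨u, hu, hlt⟩ := hstrict y hy fun u hu ↦ (Finset.mem_filter.1 (hHy hu)).2
      have := card_le_card_available_add (G := G) (L := L) (Z \ H) ψ u
      exact ⟨u, hu, by omega⟩
    obtain ⟨ψ', hψ', hne⟩ := exists_recolors_forbid (hav ψ) hall c
    exact ⟨ψ', hψ', fun u hu hyu ↦ hne u (by simp [hu, hyu])⟩

theorem reducible_singleton (hx : x ∈ Z) (hN : (L x).card ≤ N)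
    (hd : (Z.filter (G.Adj x)).card ≤ d) (hcard : d + 2 ≤ (L x).card) :
    Reducible G L N d Z {x} := by
  have hdeg : ((Z \ {x}).filter (G.Adj x)).card ≤ d :=
    (Finset.card_le_card (Finset.filter_subset_filter _ Finset.sdiff_subset)).trans hd
  refine reducible_of_card (by simpa) (by simp) (by simpa) (by simpa) ?_
    fun y _ _ ↦ ⟨x, by simp, ?_⟩
  all_goals
    simp only [Finset.mem_singleton, forall_eq, Finset.card_singleton]
    omega

theorem card_filter_adj_sdiff_add_card_of_isClique (hH : G.IsClique (H : Set V)) (hHZ : H ⊆ Z)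
    (hx : x ∈ H) :
    ((Z \ H).filter (G.Adj x)).card + H.card = (Z.filter (G.Adj x)).card + 1 := by
  have hinter : H.filter (G.Adj x) = H.erase x := by
    ext u
    rw [Finset.mem_filter, Finset.mem_erase, and_comm]
    exact and_congr_left fun hu ↦ ⟨fun h ↦ h.ne', fun h ↦ hH hx hu h.symm⟩
  have hsdiff : (Z \ H).filter (G.Adj x) = Z.filter (G.Adj x) \ H.filter (G.Adj x) := by
    ext u
    simp only [Finset.mem_filter, Finset.mem_sdiff]
    tauto
  have hcard := Finset.card_sdiff_add_card_eq_card (Finset.filter_subset_filter (G.Adj x) hHZ)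
  rw [← hsdiff, hinter] at hcard
  rw [← hcard, add_assoc, Finset.card_erase_add_one hx]

theorem reducible_triangle (hC : NoFourCycle G) (hHZ : H ⊆ Z) (hH : G.IsNClique 3 H)
    (hN : ∏ u ∈ H, (L u).card ≤ N) (hd : ∀ u ∈ H, (Z.filter (G.Adj u)).card ≤ d + 2)
    (hcard : ∀ u ∈ H, (Z.filter (G.Adj u)).card + 1 ≤ (L u).card) :
    Reducible G L N d Z H := by
  have hout : ∀ u ∈ H, ((Z \ H).filter (G.Adj u)).card + H.card =
      (Z.filter (G.Adj u)).card + 1 :=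
    fun u hu ↦ card_filter_adj_sdiff_add_card_of_isClique hH.isClique hHZ hu
  have hne : H.Nonempty := Finset.card_pos.1 (hH.card_eq ▸ Nat.succ_pos 2)
  refine reducible_of_card hHZ hne hN (fun u hu ↦ ?_) (fun u hu ↦ hout u hu ▸ hcard u hu)
    fun y hy hall ↦ ?_
  · have := hout u hu
    have := hd u hu
    have := hH.card_eq
    omega
  · obtain ⟨a, ha, b, hb, hab⟩ := Finset.one_lt_card.1 (hH.card_eq ▸ (by norm_num : 1 < 3))
    obtain ⟨z, haz, hbz, hHz⟩ := exists_eq_triple_of_isNClique hH ha hb hab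
    have hyz : y = z := hC.eq_of_adj hab (hall a ha).symm (hall b hb).symm haz hbz
    exact absurd (hHZ (hHz ▸ by simp [hyz])) hy

end Reducible

section IsLikely

variable {Ω κ : Type*} [Fintype Ω] {M N : ℕ} {p : Ω → Prop}

/-- The event `p` has probability at least `1 / N` for the uniform measure on `Ω`. -/
def IsLikely (N : ℕ) (p : Ω → Prop) : Prop :=
  Fintype.card Ω ≤ N * (Finset.univ.filter p).card

theorem IsLikely.of_le (h : IsLikely M p) (hMN : M ≤ N) : IsLikely N p :=
  h.trans (Nat.mul_le_mul_right _ hMN)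

variable [Fintype κ] {q : Ω × κ → Prop}

theorem IsLikely.prod_of_forall (h : IsLikely N p) (hpq : ∀ ω i, p ω → q (ω, i)) :
    IsLikely N q := by
  have hsub : Finset.univ.filter p ×ˢ (Finset.univ : Finset κ) ⊆ Finset.univ.filter q := by
    rintro ⟨ω, i⟩ hω
    simp only [Finset.mem_product, Finset.mem_filter_univ] at hω ⊢
    exact hpq ω i hω.1
  calc Fintype.card (Ω × κ) = Fintype.card Ω * Fintype.card κ := Fintype.card_prod _ _
    _ ≤ N * (Finset.univ.filter p).card * Fintype.card κ := Nat.mul_le_mul_right _ h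
    _ = N * (Finset.univ.filter p ×ˢ (Finset.univ : Finset κ)).card := by
      rw [Finset.card_product, Finset.card_univ, mul_assoc]
    _ ≤ N * (Finset.univ.filter q).card := Nat.mul_le_mul_left _ (Finset.card_le_card hsub)

theorem IsLikely.prod_of_exists (h : IsLikely N p) (hpq : ∀ ω, p ω → ∃ i, q (ω, i)) :
    IsLikely (Fintype.card κ * N) q := by
  have hsub : Finset.univ.filter p ⊆ (Finset.univ.filter q).image Prod.fst := fun ω hω ↦ by
    obtain ⟨i, hi⟩ := hpq ω (Finset.mem_filter_univ ω |>.1 hω)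
    exact Finset.mem_image.2 ⟨(ω, i), by simpa using hi, rfl⟩
  calc Fintype.card (Ω × κ) = Fintype.card κ * Fintype.card Ω := by
        rw [Fintype.card_prod, mul_comm]
    _ ≤ Fintype.card κ * (N * (Finset.univ.filter p).card) := Nat.mul_le_mul_left _ h
    _ ≤ Fintype.card κ * (N * (Finset.univ.filter q).card) := by
      gcongr
      exact (Finset.card_le_card hsub).trans Finset.card_image_le
    _ = Fintype.card κ * N * (Finset.univ.filter q).card := (mul_assoc ..).symm

end IsLikely

section Sample

variable {V : Type u} {C : Type v} {G : SimpleGraph V} {L : V → Finset C} {Z H : Finset V}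
  {N d : ℕ} {ψ : V → C} {Ω : Type*} [Fintype Ω] {φ : Ω → V → C}

/-- A finite family of colorings of `Z`, seen as a uniformly random coloring: every color of every
list is attained with probability at least `N ^ -(d + 1)`, and every color is avoided on up to `d`
common neighbors of a vertex outside `Z` with probability at least `N ^ -k`, where `k` is the number
of these neighbors. -/
structure IsSample (G : SimpleGraph V) (L : V → Finset C) (N d : ℕ) (Z : Finset V)
    (φ : Ω → V → C) : Prop where
  coloring : ∀ ω, IsListColoringOn G L Z (φ ω)
  avoids : ∀ I ⊆ Z, I.card ≤ d → (∃ y ∉ Z, ∀ u ∈ I, G.Adj y u) → ∀ c,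
    IsLikely (N ^ I.card) fun ω ↦ ∀ u ∈ I, φ ω u ≠ c
  attains : ∀ x ∈ Z, ∀ c ∈ L x, IsLikely (N ^ (d + 1)) fun ω ↦ φ ω x = c

theorem isSample_empty (ψ : V → C) : IsSample G L N d ∅ fun _ : Unit ↦ ψ where
  coloring := by simp [IsListColoringOn]
  avoids := by
    rintro I hI - - c
    simp [Finset.subset_empty.1 hI, IsLikely]
  attains := by simp

theorem exists_range_eq_setOf_recolors (hN : ∏ u ∈ H, (L u).card ≤ N)
    (hne : ∃ ψ', Recolors G L Z H ψ ψ') :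
    ∃ s : Fin N → V → C, Set.range s = {ψ' | Recolors G L Z H ψ ψ'} := by
  let X := {ψ' | Recolors G L Z H ψ ψ'}
  have : Nonempty X := Set.Nonempty.to_subtype hne
  let f : X → Fintype.piFinset fun u : H ↦ L u := fun ψ' ↦
    ⟨fun u ↦ ψ'.1 u, Fintype.mem_piFinset.2 fun u ↦ (ψ'.2.2 u u.2).1⟩
  have hf : Function.Injective f := by
    intro ψ₁ ψ₂ h
    ext u
    by_cases hu : u ∈ H
    · exact congrFun (congrArg Subtype.val h) ⟨u, hu⟩
    · rw [ψ₁.2.1 u hu, ψ₂.2.1 u hu]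
  have hcard : Fintype.card (Fintype.piFinset fun u : H ↦ L u) ≤ Fintype.card (Fin N) := by
    rwa [Fintype.card_coe, Fintype.card_piFinset, Fintype.card_fin, Finset.prod_coe_sort H
      fun u ↦ (L u).card]
  obtain ⟨g⟩ := Function.Embedding.nonempty_of_card_le hcard
  have hsurj := Function.invFun_surjective (g.injective.comp hf)
  exact ⟨fun i ↦ (Function.invFun (g ∘ f) i).1, (hsurj.range_comp Subtype.val).trans
    Subtype.range_coe⟩

variable {s : Ω → Fin N → V → C}

namespace IsSample

theorem avoids_prod (h : IsSample G L N d (Z \ H) φ) (hR : Reducible G L N d Z H) (hN : 0 < N)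
    (hs : ∀ ω, Set.range (s ω) = {ψ' | Recolors G L Z H (φ ω) ψ'}) {I : Finset V} (hIZ : I ⊆ Z)
    (hId : I.card ≤ d) {y : V} (hyZ : y ∉ Z) (hy : ∀ u ∈ I, G.Adj y u) (c : C) :
    IsLikely (N ^ I.card) fun a : Ω × Fin N ↦ ∀ u ∈ I, s a.1 a.2 u ≠ c := by
  have hkeep : ∀ ω i, ∀ u ∉ H, s ω i u = φ ω u := fun ω i ↦ ((hs ω).le ⟨i, rfl⟩).1
  have hprev : IsLikely (N ^ (I \ H).card) fun ω ↦ ∀ u ∈ I \ H, φ ω u ≠ c :=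
    h.avoids (I \ H) (Finset.sdiff_subset_sdiff hIZ subset_rfl)
      ((Finset.card_le_card Finset.sdiff_subset).trans hId)
      ⟨y, fun hyZH ↦ hyZ (Finset.mem_sdiff.1 hyZH).1, fun u hu ↦ hy u (Finset.mem_sdiff.1 hu).1⟩ c
  by_cases hIH : Disjoint I H
  · rw [Finset.sdiff_eq_self_of_disjoint hIH] at hprev
    refine hprev.prod_of_forall fun ω i hω u hu ↦ ?_
    rw [hkeep ω i u (Finset.disjoint_left.1 hIH hu)]
    exact hω u hu
  have hlikely : IsLikely (Fintype.card (Fin N) * N ^ (I \ H).card)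
      fun a : Ω × Fin N ↦ ∀ u ∈ I, s a.1 a.2 u ≠ c := by
    refine hprev.prod_of_exists fun ω hω ↦ ?_
    obtain ⟨ψ', hψ', hne⟩ := hR.forbid (φ ω) c y hyZ
    obtain ⟨i, rfl⟩ := (hs ω).ge hψ'
    refine ⟨i, fun u hu ↦ ?_⟩
    by_cases huH : u ∈ H
    · exact hne u huH (hy u hu)
    · rw [hkeep ω i u huH]
      exact hω u (Finset.mem_sdiff.2 ⟨hu, huH⟩)
  have hlt : (I \ H).card < I.card := by
    refine Finset.card_lt_card (Finset.sdiff_subset.ssubset_of_ne fun heq ↦ ?_)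
    exact hIH (Finset.sdiff_eq_self_iff_disjoint.1 heq)
  rw [Fintype.card_fin, ← pow_succ'] at hlikely
  exact hlikely.of_le (Nat.pow_le_pow_right hN hlt)

theorem attains_prod (h : IsSample G L N d (Z \ H) φ) (hR : Reducible G L N d Z H) (hN : 0 < N)
    (hs : ∀ ω, Set.range (s ω) = {ψ' | Recolors G L Z H (φ ω) ψ'}) {x : V} (hx : x ∈ Z) {c : C}
    (hc : c ∈ L x) : IsLikely (N ^ (d + 1)) fun a : Ω × Fin N ↦ s a.1 a.2 x = c := by
  by_cases hxH : x ∉ H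
  · refine (h.attains x (Finset.mem_sdiff.2 ⟨hx, hxH⟩) c hc).prod_of_forall fun ω i hω ↦ ?_
    exact (((hs ω).le ⟨i, rfl⟩).1 x hxH).trans hω
  rw [not_not] at hxH
  have hdeg := hR.outer_degree_le x hxH
  have hprev : IsLikely (N ^ ((Z \ H).filter (G.Adj x)).card)
      fun ω ↦ ∀ u ∈ (Z \ H).filter (G.Adj x), φ ω u ≠ c :=
    h.avoids _ (Finset.filter_subset _ _) hdeg
      ⟨x, fun hxZH ↦ (Finset.mem_sdiff.1 hxZH).2 hxH, fun u hu ↦ (Finset.mem_filter.1 hu).2⟩ c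
  have hlikely : IsLikely (Fintype.card (Fin N) * N ^ ((Z \ H).filter (G.Adj x)).card)
      fun a : Ω × Fin N ↦ s a.1 a.2 x = c := by
    refine hprev.prod_of_exists fun ω hω ↦ ?_
    obtain ⟨ψ', hψ', hψ'x⟩ := hR.fix (φ ω) x hxH c hc
      fun u hu hxu ↦ hω u (Finset.mem_filter.2 ⟨hu, hxu⟩)
    obtain ⟨i, rfl⟩ := (hs ω).ge hψ'
    exact ⟨i, hψ'x⟩
  rw [Fintype.card_fin, ← pow_succ'] at hlikely
  exact hlikely.of_le (Nat.pow_le_pow_right hN (Nat.succ_le_succ hdeg))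

theorem prod (h : IsSample G L N d (Z \ H) φ) (hR : Reducible G L N d Z H) (hN : 0 < N)
    (hs : ∀ ω, Set.range (s ω) = {ψ' | Recolors G L Z H (φ ω) ψ'}) :
    IsSample G L N d Z fun a : Ω × Fin N ↦ s a.1 a.2 where
  coloring a := Recolors.isListColoringOn ((hs a.1).le ⟨a.2, rfl⟩) (h.coloring a.1)
  avoids _ hIZ hId := fun ⟨_, hyZ, hy⟩ c ↦ h.avoids_prod hR hN hs hIZ hId hyZ hy c
  attains _ hx _ hc := h.attains_prod hR hN hs hx hc

theorem div_mul_sum_le [Fintype V] (h : IsSample G L N d Finset.univ φ) {w : V → C → ℝ}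
    (hw : IsWeightedRequest L w) (x : V) :
    Fintype.card Ω * (1 / N ^ (d + 1) * ∑ c ∈ L x, w x c) ≤ ∑ ω, w x (φ ω x) := by
  have hfiber : ∑ ω, w x (φ ω x) =
      ∑ c ∈ L x, ((Finset.univ.filter fun ω ↦ φ ω x = c).card : ℝ) * w x c := by
    rw [← Finset.sum_fiberwise_of_maps_to' fun ω _ ↦ (h.coloring ω x (Finset.mem_univ x)).1]
    simp only [Finset.sum_const, nsmul_eq_mul]
  rw [hfiber, ← mul_assoc, Finset.mul_sum]
  refine Finset.sum_le_sum fun c hc ↦ mul_le_mul_of_nonneg_right ?_ (hw x c hc)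
  rw [mul_one_div]
  refine div_le_of_le_mul₀ (by positivity) (by positivity) ?_
  rw [mul_comm]
  exact_mod_cast h.attains x (Finset.mem_univ x) c hc

theorem weightedFlexible [Fintype V] [Nonempty Ω] (h : IsSample G L N d Finset.univ φ) :
    WeightedFlexible G L (1 / N ^ (d + 1)) := by
  intro w hw
  have hsum : ∑ _ω : Ω, 1 / N ^ (d + 1) * totalWeight L w ≤ ∑ ω, ∑ x, w x (φ ω x) := by
    rw [Finset.sum_comm, Finset.sum_const, Finset.card_univ, nsmul_eq_mul, totalWeight,
      Finset.mul_sum, Finset.mul_sum]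
    exact Finset.sum_le_sum fun x _ ↦ h.div_mul_sum_le hw x
  obtain ⟨ω, -, hω⟩ := Finset.exists_le_of_sum_le Finset.univ_nonempty hsum
  exact ⟨φ ω, ⟨fun x y ↦ (h.coloring ω x (Finset.mem_univ x)).2 y (Finset.mem_univ y),
    fun x ↦ (h.coloring ω x (Finset.mem_univ x)).1⟩, hω⟩

end IsSample

theorem exists_isSample (hL : ∀ x, (L x).Nonempty)
    (hred : ∀ Z : Finset V, Z.Nonempty → ∃ H, Reducible G L N d Z H) (Z : Finset V) :
    ∃ (Ω : Type) (_ : Fintype Ω) (_ : Nonempty Ω) (φ : Ω → V → C), IsSample G L N d Z φ := by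
  induction Z using Finset.strongInduction with
  | H Z ih =>
    rcases Z.eq_empty_or_nonempty with rfl | hZ
    · choose ψ _ using hL
      exact ⟨Unit, inferInstance, inferInstance, _, isSample_empty ψ⟩
    obtain ⟨H, hR⟩ := hred Z hZ
    have hN : 0 < N := (Finset.prod_pos fun x _ ↦ (hL x).card_pos).trans_le hR.prod_card_le
    obtain ⟨Ω, _, _, φ, hφ⟩ := ih _ (Finset.sdiff_ssubset hR.subset hR.nonempty)
    choose s hs using fun ω ↦ exists_range_eq_setOf_recolors hR.prod_card_le (hR.extend (φ ω))
    have : Nonempty (Fin N) := ⟨⟨0, hN⟩⟩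
    exact ⟨Ω × Fin N, inferInstance, inferInstance, _, hφ.prod hR hN hs⟩

theorem weightedFlexible_of_reducible [Fintype V] (hL : ∀ x, (L x).Nonempty)
    (hred : ∀ Z : Finset V, Z.Nonempty → ∃ H, Reducible G L N d Z H) :
    WeightedFlexible G L (1 / N ^ (d + 1)) := by
  obtain ⟨Ω, _, _, φ, hφ⟩ := exists_isSample hL hred Finset.univ
  exact hφ.weightedFlexible

theorem exists_reducible_of_isPlanar (hP : IsPlanar G) (hC : NoFourCycle G)
    (hL : ∀ x, (L x).card = 5) (hZ : Z.Nonempty) : ∃ H, Reducible G L (5 ^ 3) 3 Z H := by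
  rcases hP.exists_light_configuration hC hZ with ⟨x, hx, hdeg⟩ | ⟨H, hHZ, hH, hdeg⟩
  · exact ⟨{x}, reducible_singleton hx (by simp [hL]) hdeg (hL x).ge⟩
  · refine ⟨H, reducible_triangle hC hHZ hH ?_ (fun u hu ↦ ?_) fun u hu ↦ ?_⟩
    · simp [hL, hH.card_eq]
    · simp [hdeg u hu]
    · rw [hdeg u hu, hL]

end Sample

end Flexibility

theorem theorem1 :
    ∃ ε : ℝ, 0 < ε ∧
      ∀ (V : Type*) [Fintype V] (C : Type*) (G : SimpleGraph V) (L : V → Finset C),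
        Flexibility.IsPlanar G → Flexibility.NoFourCycle G → (∀ x : V, (L x).card = 5) →
          Flexibility.WeightedFlexible G L ε := by
  refine ⟨1 / ((5 ^ 3 : ℕ) : ℝ) ^ (3 + 1), by positivity, fun V _ C G L hP hC hL ↦ ?_⟩
  have hne : ∀ x, (L x).Nonempty := fun x ↦ Finset.card_pos.1 (by rw [hL]; norm_num)
  exact Flexibility.weightedFlexible_of_reducible hne
    fun Z hZ ↦ Flexibility.exists_reducible_of_isPlanar hP hC hL hZ
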